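/- **Theorem (Convergence guarantee of POP-BO).** Setting. Let $\mathcal X\subset\mathbb R^d$ be compact and nonempty, let $k$ be a continuous symmetric positive semidefinite kernel on $\mathbb R^d$ with $k(a,b)\le 1$ for all $a,b\in\mathcal X$, let $\mathcal H_k$ be its reproducing kernel Hilbert space, $B\ge 0$, $\mathcal B_f=\{g\in\mathcal H_k:\|g\|_k\le B\}$, and let $f\in\mathcal B_f$ be unknown, with $x^\star\in\arg\max_{x\in\mathcal X}f(x)$. A query $(x,x')$ to the comparison oracle returns, given the past and the queried pair, a Bernoulli variable with success probability $\sigma(f(x)-f(x'))$, where $\sigma(u)=1/(1+e^{-u})$. Let $T\ge1$, $\lambda>0$, $\delta\in(0,1)$ and $\epsilon=1/T$. Notation. Let $\mathcal N$ be the smallest number of elements of $\mathcal B_f$ such that the closed $\epsilon$-balls around them, for the supremum norm over $\mathcal X$, cover $\mathcal B_f$. Put $\bar\sigma=\frac1{1+e^{-2B}}$, $\underline\sigma=\frac1{1+e^{2B}}$, $\underline{\sigma'}=\frac1{2+e^{2B}+e^{-2B}}$, $\overline{\sigma'}=\frac14$, $B_p=\frac{\bar\sigma}{\underline\sigma}-\frac{\underline\sigma}{\bar\sigma}$,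 $H_\sigma=\frac1{2\bar\sigma^2}$, $C_L=1+\frac2{1+e^{-2B}}$, and, for $\eta>0$, $$\beta_1(\epsilon,\eta,t)=\sqrt{32tB^2\log\tfrac{\pi^2t^2\mathcal N}{6\eta}}+C_L\epsilon t,\qquad \beta_2(\epsilon,\eta,t)=8H_\sigma\overline{\sigma'}^2\epsilon^2t+2C_L\epsilon t+\sqrt{8tB_p^2\log\tfrac{\pi^2t^2\mathcal N}{3\eta}},$$ $$\beta(\epsilon,\eta,t)=\frac{\underline{\sigma'}^2}{H_\sigma}\big(\beta_2(\epsilon,\eta,t)+2\beta_1(\epsilon,\eta,t)\big).$$ Let $k^{ff'}((a,a'),(b,b'))=k(a,b)+k(a',b')$. For $\omega_\tau=(x_\tau,x_\tau')$ let $$\sigma_t^{ff'}(\omega)^2=k^{ff'}(\omega,\omega)-k^{ff'}(\omega_{1:t-1},\omega)^\top\big(K^{ff'}_{t-1}+\lambda I\big)^{-1}k^{ff'}(\omega_{1:t-1},\omega),$$ where $K^{ff'}_{t-1}$ is the matrix of $k^{ff'}$ at $\omega_1,\dots,\omega_{t-1}$, and let $\gamma_T^{ff'}$ be the maximum of $\frac12\log\det(I+\lambda^{-1}K^{ff'}_\Omega)$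 over all families $\Omega$ of $T$ points of $\mathcal X\times\mathcal X$, repetitions allowed, $K^{ff'}_\Omega$ being the matrix of $k^{ff'}$ on $\Omega$. Algorithm. Start at some $x_0\in\mathcal X$ with $\mathcal B_f^1=\mathcal B_f$. At step $t=1,\dots,T$ put $x_t'=x_{t-1}$, choose $x_t\in\arg\max_{x\in\mathcal X}\max_{\tilde f\in\mathcal B_f^t}(\tilde f(x)-\tilde f(x_t'))$, query the oracle at $(x_t,x_t')$, compute a maximizer $\hat f_t^{\mathrm{MLE}}$ over $\mathcal B_f$ of the log-likelihood $\ell_t$ of the first $t$ comparisons, and put $\mathcal B_f^{t+1}=\{\tilde f\in\mathcal B_f:\ell_t(\tilde f)\ge\ell_t(\hat f^{\mathrm{MLE}}_t)-\beta_1(\epsilon,\delta/2,t)\}$. Finally report $x_{t^\star}$ with $$t^\star\in\arg\min_{t\in\{1,\dots,T\}}2\big(2B+\lambda^{-1/2}\sqrt{\beta(\epsilon,\delta/2,t)}\big)\,\sigma_t^{ff'}((x_t,x_t')).$$ Claim. There is a constant $C>0$ that depends only on $B$ and $\lambda$ such that, with probability at least $1-\delta$, every such $t^\star$ satisfies $$f(x^\star)-f(x_{t^\star})\le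 C\,\frac{\sqrt{\beta_T\,\gamma_T^{ff'}}}{\sqrt T},\qquad \beta_T=\beta(1/T,\delta,T).$$ -/

import Mathlib

open MeasureTheory ProbabilityTheory

noncomputable section

namespace PopBO

/-! ### The kernel and the comparison model -/

section Kernel

variable {d : ℕ} (H : Type*) [NormedAddCommGroup H] [InnerProductSpace ℝ H] [CompleteSpace H]
  [RKHS ℝ H (EuclideanSpace ℝ (Fin d)) ℝ]

/-- The real-valued reproducing kernel `k(a, b)` of an RKHS of real functions on `ℝ^d`
(Mathlib's kernel takes values in the linear maps `ℝ →L[ℝ] ℝ`). -/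
def ker (a b : EuclideanSpace ℝ (Fin d)) : ℝ := RKHS.kernel H a b 1

/-- The additive kernel `k^{ff'}((a, a'), (b, b')) = k(a, b) + k(a', b')` on pairs of points. -/
def pairKer (v w : EuclideanSpace ℝ (Fin d) × EuclideanSpace ℝ (Fin d)) : ℝ :=
  ker H v.1 w.1 + ker H v.2 w.2

/-- The kernel matrix of `n` pairs for the additive kernel. -/
def pairGram {n : ℕ} (w : Fin n → EuclideanSpace ℝ (Fin d) × EuclideanSpace ℝ (Fin d)) :
    Matrix (Fin n) (Fin n) ℝ :=
  Matrix.of fun i j => pairKer H (w i) (w j)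

/-- The uncertainty function of the additive kernel at `v`, given the pairs `w`:
the square root of `k(v, v) - k(w, v)ᵀ (K + lam I)⁻¹ k(w, v)`. -/
def pairSigma (lam : ℝ) {n : ℕ}
    (w : Fin n → EuclideanSpace ℝ (Fin d) × EuclideanSpace ℝ (Fin d))
    (v : EuclideanSpace ℝ (Fin d) × EuclideanSpace ℝ (Fin d)) : ℝ :=
  √(pairKer H v v -
    (fun i => pairKer H (w i) v) ⬝ᵥ
      ((pairGram H w + lam • (1 : Matrix (Fin n) (Fin n) ℝ))⁻¹.mulVec
        fun i => pairKer H (w i) v))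

/-- `σ_t^{ff'}((x_t, x_t'))` along a sequence of points, with `x_t' = x_{t-1}`: the uncertainty
at the pair `(x_t, x_{t-1})` given the pairs `(x_τ, x_{τ-1})`, `τ = 1, …, t - 1`. -/
def stepSigma (lam : ℝ) (x : ℕ → EuclideanSpace ℝ (Fin d)) (t : ℕ) : ℝ :=
  pairSigma H lam (fun i : Fin (t - 1) => (x (i + 1), x i)) (x t, x (t - 1))

/-- The maximum information gain `γ_T^{ff'}`: the maximum of `(1/2) log det (I + lam⁻¹ K_w)` over
all families `w` of `T` pairs of points of `X` (repetitions allowed). -/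
def infoGain (X : Set (EuclideanSpace ℝ (Fin d))) (lam : ℝ) (T : ℕ) : ℝ :=
  ⨆ w : Fin T → (X ×ˢ X : Set (EuclideanSpace ℝ (Fin d) × EuclideanSpace ℝ (Fin d))),
    1 / 2 * Real.log
      (1 + lam⁻¹ • pairGram H (fun i => (w i :
        EuclideanSpace ℝ (Fin d) × EuclideanSpace ℝ (Fin d)))).det

/-- The covering number of the ball of radius `B` of the RKHS, for the supremum norm over `X`. The
metric of `X →ᵤ ℝ` is the (extended) supremum distance of functions on `X`. -/
def coverNum (X : Set (EuclideanSpace ℝ (Fin d))) (B ε : ℝ) : ℕ :=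
  (Metric.coveringNumber ε.toNNReal
    ((fun g : H => UniformFun.ofFun fun a : X => g (a : EuclideanSpace ℝ (Fin d))) ''
      Metric.closedBall (0 : H) B)).toNat

/-! ### The constants and the confidence parameters -/

/-- `1 / (1 + e^{2B})`, a lower bound for the preference probabilities. -/
def sigLow (B : ℝ) : ℝ := 1 / (1 + Real.exp (2 * B))

/-- `1 / (1 + e^{-2B})`, an upper bound for the preference probabilities. -/
def sigUp (B : ℝ) : ℝ := 1 / (1 + Real.exp (-2 * B))

/-- `1 / (2 + e^{2B} + e^{-2B})`, a lower bound for the derivative of the link function. -/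
def dsigLow (B : ℝ) : ℝ := 1 / (2 + Real.exp (2 * B) + Real.exp (-2 * B))

/-- `1 / 4`, an upper bound for the derivative of the link function. -/
def dsigUp : ℝ := 1 / 4

/-- The constant `B_p`. -/
def constBp (B : ℝ) : ℝ := sigUp B / sigLow B - sigLow B / sigUp B

/-- The constant `H_σ`. -/
def constH (B : ℝ) : ℝ := 1 / (2 * sigUp B ^ 2)

/-- The constant `C_L`. -/
def constL (B : ℝ) : ℝ := 1 + 2 / (1 + Real.exp (-2 * B))

/-- The likelihood slack `β₁(ε, δ, t)`. -/
def beta1 (X : Set (EuclideanSpace ℝ (Fin d))) (B ε δ : ℝ) (t : ℕ) : ℝ :=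
  √(32 * t * B ^ 2 * Real.log (Real.pi ^ 2 * t ^ 2 * coverNum H X B ε / (6 * δ)))
    + constL B * ε * t

/-- The quantity `β₂(ε, δ, t)`. -/
def beta2 (X : Set (EuclideanSpace ℝ (Fin d))) (B ε δ : ℝ) (t : ℕ) : ℝ :=
  8 * constH B * dsigUp ^ 2 * ε ^ 2 * t + 2 * constL B * ε * t
    + √(8 * t * constBp B ^ 2 *
        Real.log (Real.pi ^ 2 * t ^ 2 * coverNum H X B ε / (3 * δ)))

/-- The quantity `β(ε, δ, t)`. -/
def beta (X : Set (EuclideanSpace ℝ (Fin d))) (B ε δ : ℝ) (t : ℕ) : ℝ :=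
  dsigLow B ^ 2 / constH B * (beta2 H X B ε δ t + 2 * beta1 H X B ε δ t)

/-- The known confidence width `2 (2B + lam^{-1/2} √β(ε, δ, t)) σ_t^{ff'}((x_t, x_t'))` of step
`t`. -/
def width (X : Set (EuclideanSpace ℝ (Fin d))) (B lam ε δ : ℝ)
    (x : ℕ → EuclideanSpace ℝ (Fin d)) (t : ℕ) : ℝ :=
  2 * (2 * B + (√lam)⁻¹ * √(beta H X B ε δ t)) * stepSigma H lam x t

end Kernel

/-! ### Likelihood, confidence sets and the algorithm -/

section Algorithm

variable {d : ℕ} {H : Type*} [NormedAddCommGroup H] [InnerProductSpace ℝ H] [CompleteSpace H]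
  [RKHS ℝ H (EuclideanSpace ℝ (Fin d)) ℝ]

/-- The likelihood of `g` for one comparison of `a` with `a'`; the outcome `true` means that `a`
is preferred. -/
def pairLik (g : H) (a a' : EuclideanSpace ℝ (Fin d)) (b : Bool) : ℝ :=
  if b then Real.sigmoid (g a - g a') else 1 - Real.sigmoid (g a - g a')

/-- The log-likelihood `ℓ_t(g)` of the first `t` comparisons, of `x_τ` with `x_{τ-1}` with outcome
`y_τ`, `τ = 1, …, t`. -/
def logLik (x : ℕ → EuclideanSpace ℝ (Fin d)) (y : ℕ → Bool) (t : ℕ) (g : H) : ℝ :=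
  ∑ τ ∈ Finset.Icc 1 t, Real.log (pairLik g (x τ) (x (τ - 1)) (y τ))

/-- `m` maximizes the likelihood of the first `t` comparisons over the ball of radius `B`. -/
def IsMLE (B : ℝ) (x : ℕ → EuclideanSpace ℝ (Fin d)) (y : ℕ → Bool) (t : ℕ) (m : H) : Prop :=
  ‖m‖ ≤ B ∧ ∀ g : H, ‖g‖ ≤ B → logLik x y t g ≤ logLik x y t m

/-- The confidence set after `t` comparisons (with the index `t + 1` in the usual notation), `m`
being a maximum likelihood estimate. After no comparison it is the whole ball. -/
def confSet (X : Set (EuclideanSpace ℝ (Fin d))) (B ε δ : ℝ)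
    (x : ℕ → EuclideanSpace ℝ (Fin d)) (y : ℕ → Bool) (t : ℕ) (m : H) : Set H :=
  {g | ‖g‖ ≤ B ∧ (1 ≤ t → logLik x y t m - beta1 H X B ε δ t ≤ logLik x y t g)}

/-- A run of the optimistic preferential algorithm over the steps `t = 1, …, T`, on a probability
space, with unknown function `f`, norm bound `B` and confidence sets with the parameters `ε` and
`δ`. Here `x 0` is the initial point, `x t` is the point chosen at step `t` and compared with
`x (t - 1)`, `y t` is the outcome, `mle t` is the maximum likelihood estimate after `t`
comparisons, and `opt t` is the optimistic function of step `t`. The σ-algebra `ℱ t` holds what is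
known just before the outcome `y (t + 1)` is revealed: the first `t` outcomes and the
algorithm's own randomness, so that the points up to `x (t + 1)` are measurable for it. -/
structure IsRun {Ω : Type*} [mΩ : MeasurableSpace Ω] (P : Measure Ω) (ℱ : Filtration ℕ mΩ)
    (X : Set (EuclideanSpace ℝ (Fin d))) (B ε δ : ℝ) (f : H) (T : ℕ)
    (x : ℕ → Ω → EuclideanSpace ℝ (Fin d)) (y : ℕ → Ω → Bool) (mle opt : ℕ → Ω → H) : Prop where
  /-- The points lie in the search space. -/
  mem : ∀ t ≤ T, ∀ ω, x t ω ∈ X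
  /-- The initial point is known at the beginning. -/
  meas_init : Measurable[ℱ 0] (x 0)
  /-- The point of step `t` is chosen before the outcome of step `t` is revealed. -/
  meas_point : ∀ t ∈ Finset.Icc 1 T, Measurable[ℱ (t - 1)] (x t)
  /-- The outcome of step `t` is known after step `t`. -/
  meas_outcome : ∀ t ∈ Finset.Icc 1 T, Measurable[ℱ t] (y t)
  /-- Given the past and the compared pair, the outcome is a Bernoulli variable with success
  probability `σ(f(x_t) - f(x_{t-1}))`. -/
  oracle : ∀ t ∈ Finset.Icc 1 T,
    P⟦{ω | y t ω = true} | ℱ (t - 1)⟧ =ᵐ[P]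
      fun ω => Real.sigmoid (f (x t ω) - f (x (t - 1) ω))
  /-- The maximum likelihood estimates. -/
  mle_spec : ∀ t ∈ Finset.Icc 1 T, ∀ ω, IsMLE B (x · ω) (y · ω) t (mle t ω)
  /-- The optimistic function of step `t` belongs to the current confidence set. -/
  opt_mem : ∀ t ∈ Finset.Icc 1 T, ∀ ω,
    opt t ω ∈ confSet X B ε δ (x · ω) (y · ω) (t - 1) (mle (t - 1) ω)
  /-- The point and the optimistic function of step `t` jointly maximize the advantage over the
  reference point `x_{t-1}`. -/
  opt_max : ∀ t ∈ Finset.Icc 1 T, ∀ ω, ∀ a ∈ X,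
    ∀ g ∈ confSet X B ε δ (x · ω) (y · ω) (t - 1) (mle (t - 1) ω),
      g a - g (x (t - 1) ω) ≤ opt t ω (x t ω) - opt t ω (x (t - 1) ω)

end Algorithm

end PopBO

end

noncomputable section

/-! The log-likelihood of one comparison is a concave function of the increment `g (x τ) - g (x (τ -
1))`, with curvature at least `dsigLow B` on `[-2B, 2B]`. Hence the log-likelihood ratio of `g`
against `f` is at most a martingale, the score, minus a multiple of the squared distance between
their increments (`logLik_sub_le`). Azuma–Hoeffding (`IsScore.tail`) and a union bound over the
times and over a finite sup-norm net of the ball control all scores at once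
(`IsRun.measure_not_good_le`). Then `f` lies in every confidence set, and every member of a
confidence set has past increments close to those of `f` (`GoodScores.logLik_le`,
`GoodScores.sum_sq_le`).

The increment of `h = g - f` over a pair is the inner product of `(h, -h)` with the feature of the
pair, so closeness along past pairs controls the increment at the new pair through the posterior
deviation (`abs_sub_le_pairSigma`). With optimism, the regret of a step is at most a constant times
its width (`IsRun.regret_le_width`). The factor `dsigLow B ^ 2 / constH B` in `beta` makes the width
small, but the loss is `widthRatio B`, which depends only on `B` and goes into `C`. Finally the
smallest width is at most the average one, and Cauchy–Schwarz together with the bound of the summed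
posterior variances by the information gain (`sum_stepSigma_sq_le`) gives the rate
(`width_argmin_le`). -/

namespace PopBO

/-! ### Features of points, and finite nets of the RKHS ball. -/

section Features

variable {d : ℕ} {H : Type*} [NormedAddCommGroup H] [InnerProductSpace ℝ H] [CompleteSpace H]
  [RKHS ℝ H (EuclideanSpace ℝ (Fin d)) ℝ]

variable (H) in
/-- The canonical feature of the point `a`, which represents the evaluation at `a`. -/
def feat (a : EuclideanSpace ℝ (Fin d)) : H := RKHS.kerFun H a (1 : ℝ)

lemma inner_feat_left (a : EuclideanSpace ℝ (Fin d)) (g : H) : inner ℝ (feat H a) g = g a := by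
  simp [feat, RKHS.kerFun_inner]

lemma inner_feat_right (a : EuclideanSpace ℝ (Fin d)) (g : H) : inner ℝ g (feat H a) = g a := by
  rw [real_inner_comm, inner_feat_left]

lemma inner_feat_feat (a b : EuclideanSpace ℝ (Fin d)) :
    inner ℝ (feat H a) (feat H b) = ker H a b := by
  rw [inner_feat_left, feat, RKHS.kerFun_apply, ker]

lemma norm_feat_le_one {a : EuclideanSpace ℝ (Fin d)} (h : ker H a a ≤ 1) : ‖feat H a‖ ≤ 1 := by
  rw [← inner_feat_feat, real_inner_self_eq_norm_sq] at h
  nlinarith [norm_nonneg (feat H a)]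

lemma abs_apply_le_norm {a : EuclideanSpace ℝ (Fin d)} (h : ker H a a ≤ 1) (g : H) :
    |g a| ≤ ‖g‖ := by
  rw [← inner_feat_left]
  exact (abs_real_inner_le_norm _ _).trans
    (mul_le_of_le_one_left (norm_nonneg _) (norm_feat_le_one h))

lemma continuous_feat (hk : Continuous fun p : EuclideanSpace ℝ (Fin d) ×
    EuclideanSpace ℝ (Fin d) => ker H p.1 p.2) : Continuous (feat H (d := d)) := by
  refine continuous_iff_continuousAt.2 fun a => ?_
  rw [ContinuousAt, tendsto_iff_norm_sub_tendsto_zero]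
  have h1 : ∀ b, ‖feat H b - feat H a‖ = √(ker H b b - 2 * ker H b a + ker H a a) := by
    intro b
    have h := norm_sub_sq_real (feat H b) (feat H a)
    rw [← real_inner_self_eq_norm_sq (feat H b), ← real_inner_self_eq_norm_sq (feat H a),
      inner_feat_feat, inner_feat_feat, inner_feat_feat] at h
    rw [← h, Real.sqrt_sq (norm_nonneg _)]
  have h2 : Continuous fun b => √(ker H b b - 2 * ker H b a + ker H a a) := by
    have e1 := hk.comp (continuous_id.prodMk continuous_id)
    have e2 := hk.comp (continuous_id.prodMk (continuous_const (y := a)))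
    exact ((e1.sub (e2.const_mul 2)).add continuous_const).sqrt
  simp_rw [h1]
  have h3 := h2.tendsto a
  have h4 : ker H a a - 2 * ker H a a + ker H a a = 0 := by ring
  simpa [h4] using h3

lemma continuous_coe (hk : Continuous fun p : EuclideanSpace ℝ (Fin d) ×
    EuclideanSpace ℝ (Fin d) => ker H p.1 p.2) (g : H) :
    Continuous fun a : EuclideanSpace ℝ (Fin d) => g a := by
  simp_rw [← inner_feat_left]
  exact (continuous_feat hk).inner continuous_const

/-- A ball of the RKHS is totally bounded for the uniform distance on a compact set. -/
lemma totallyBounded_image_ball {X : Set (EuclideanSpace ℝ (Fin d))} (hX : IsCompact X)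
    (hker : ∀ a ∈ X, ∀ b ∈ X, ker H a b ≤ 1)
    (hk : Continuous fun p : EuclideanSpace ℝ (Fin d) × EuclideanSpace ℝ (Fin d) =>
      ker H p.1 p.2) (B : ℝ) :
    TotallyBounded ((fun g : H => UniformFun.ofFun fun a : X =>
      g (a : EuclideanSpace ℝ (Fin d))) '' Metric.closedBall (0 : H) B) := by
  have : CompactSpace X := isCompact_iff_compactSpace.1 hX
  let F : Metric.closedBall (0 : H) B → X → ℝ := fun g a => (g : H) a
  -- One modulus serves the whole ball: `|g b - g a| ≤ ‖g‖ * ‖feat H b - feat H a‖`, and the feature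
  -- map is continuous.
  have hF : Equicontinuous F := by
    intro a
    refine Metric.equicontinuousAt_iff.2 fun ε hε => ?_
    obtain ⟨r, hr, h⟩ := Metric.continuous_iff.1
      ((continuous_feat hk).comp continuous_subtype_val : Continuous fun a : X => feat H a.1) a
      (ε / (|B| + 1)) (by positivity)
    refine ⟨r, hr, fun b hb g => ?_⟩
    have hg : ‖(g : H)‖ ≤ B := mem_closedBall_zero_iff.1 g.2
    have h1 := h b hb
    rw [dist_eq_norm, lt_div_iff₀ (by positivity)] at h1
    rw [dist_comm, Real.dist_eq]
    change |(g : H) b - (g : H) a| < ε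
    rw [← inner_feat_left, ← inner_feat_left, ← inner_sub_left]
    calc _ ≤ _ := abs_real_inner_le_norm _ _
      _ ≤ ‖feat H (b : EuclideanSpace ℝ (Fin d)) - feat H a‖ * (|B| + 1) := by
        gcongr; linarith [le_abs_self B]
      _ < ε := h1
  -- Arzelà–Ascoli: for an equicontinuous family on a compact space, the uniformities of pointwise
  -- and of uniform convergence agree. Pointwise, the ball lies in a product of compact intervals.
  let : UniformSpace (Metric.closedBall (0 : H) B) := (Pi.uniformSpace _).comap F
  have hi : IsUniformInducing F := ⟨rfl⟩
  have hi' := hF.isUniformInducing_uniformFun_iff_pi.2 hi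
  have hpi : TotallyBounded (F '' Set.univ) := by
    refine TotallyBounded.subset ?_ (isCompact_univ_pi fun _ : X =>
      isCompact_Icc (a := -B) (b := B)).totallyBounded
    rintro _ ⟨g, -, rfl⟩ a -
    have hg : ‖(g : H)‖ ≤ B := mem_closedBall_zero_iff.1 g.2
    exact abs_le.1 ((abs_apply_le_norm (hker _ a.2 _ a.2) _).trans hg)
  have := ((totallyBounded_image_iff hi').2 ((totallyBounded_image_iff hi).1 hpi))
  convert this using 1
  ext u
  simp [F]

/-- The covering number is attained by a finite net of functions in the ball. -/
lemma exists_net {X : Set (EuclideanSpace ℝ (Fin d))} (hX : IsCompact X)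
    (hker : ∀ a ∈ X, ∀ b ∈ X, ker H a b ≤ 1)
    (hk : Continuous fun p : EuclideanSpace ℝ (Fin d) × EuclideanSpace ℝ (Fin d) =>
      ker H p.1 p.2) {B ε : ℝ} (hB : 0 ≤ B) (hε : 0 < ε) :
    1 ≤ coverNum H X B ε ∧ ∃ N : Fin (coverNum H X B ε) → H, (∀ i, ‖N i‖ ≤ B) ∧
      ∀ g : H, ‖g‖ ≤ B → ∃ i, ∀ a ∈ X, |g a - N i a| ≤ ε := by
  set J : H → UniformFun X ℝ := fun g => UniformFun.ofFun fun a : X =>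
      g (a : EuclideanSpace ℝ (Fin d)) with hJ
  set A := J '' Metric.closedBall (0 : H) B with hA
  have hε' : ε.toNNReal ≠ 0 := by simpa using hε
  have hne : A.Nonempty := ⟨_, 0, by simpa using hB, rfl⟩
  -- Finiteness is needed for `coverNum` to be meaningful, since `toNat` sends `⊤` to `0`.
  have hfin : Metric.coveringNumber ε.toNNReal A ≠ ⊤ := by
    obtain ⟨C, hCA, hC, hcov⟩ := Metric.exists_finite_isCover_of_totallyBounded hε'
      (totallyBounded_image_ball hX hker hk B)
    exact ne_top_of_le_ne_top (by simpa using hC) (hcov.coveringNumber_le_encard hCA)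
  have hcast : ((coverNum H X B ε : ℕ) : ℕ∞) = Metric.coveringNumber ε.toNNReal A :=
    ENat.natCast_toNat hfin
  refine ⟨?_, ?_⟩
  · have := Metric.coveringNumber_pos_iff (ε := ε.toNNReal).2 hne
    rw [← hcast] at this
    exact_mod_cast this
  obtain ⟨C, hCA, hCf, hcov, hcard⟩ := Metric.exists_set_encard_eq_coveringNumber hfin
  have hcard' : C.ncard = coverNum H X B ε := by
    rw [Set.ncard, hcard]; rfl
  have := hCf.to_subtype
  have e : Fin (coverNum H X B ε) ≃ C := by
    refine (Finite.equivFinOfCardEq ?_).symm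
    rw [← hcard']; rfl
  choose N hN hNe using fun i => hCA (e i).2
  refine ⟨N, fun i => by simpa using hN i, fun g hg => ?_⟩
  obtain ⟨c, hc, hgc⟩ := hcov (show J g ∈ A from ⟨g, by simpa using hg, rfl⟩)
  refine ⟨e.symm ⟨c, hc⟩, fun a ha => ?_⟩
  have h1 : J (N (e.symm ⟨c, hc⟩)) = c := by rw [hNe]; simp
  have h2 : edist (J g) c ≤ (ε.toNNReal : ENNReal) := hgc
  rw [← h1] at h2
  have h3 := UniformFun.edist_le.1 h2 ⟨a, ha⟩
  rw [edist_dist, Real.dist_eq] at h3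
  have h4 := (ENNReal.ofReal_le_ofReal_iff hε.le).1 h3
  exact h4

end Features

/-! ### Posterior variance as a ridge regression residual, and log determinants. -/

section GramResidual

open Matrix

variable {E : Type*} [NormedAddCommGroup E] [InnerProductSpace ℝ E] {ι : Type*} [Fintype ι]
  [DecidableEq ι]

/-- The regularized residual of `v` given the vectors `φ i`: the posterior variance at `v`. -/
def residual (lam : ℝ) (φ : ι → E) (v : E) : ℝ :=
  inner ℝ v v - (fun i => inner ℝ (φ i) v) ⬝ᵥ
    ((Matrix.gram ℝ φ + lam • (1 : Matrix ι ι ℝ))⁻¹.mulVec fun i => inner ℝ (φ i) v)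

lemma posDef_gram_add {lam : ℝ} (hlam : 0 < lam) (φ : ι → E) :
    (Matrix.gram ℝ φ + lam • (1 : Matrix ι ι ℝ)).PosDef :=
  Matrix.PosDef.posSemidef_add (Matrix.posSemidef_gram ℝ φ) (Matrix.PosDef.one.smul hlam)

/-- The witness `c = (G + lam I)⁻¹ k` is the ridge regression coefficient vector, and the right side
is the ridge loss at `c`. It collapses because `cᵀ (G + lam I) c = kᵀ c`. -/
lemma residual_eq {lam : ℝ} (hlam : 0 < lam) (φ : ι → E) (v : E) :
    ∃ c : ι → ℝ, residual lam φ v = ‖v - ∑ i, c i • φ i‖ ^ 2 + lam * ∑ i, c i ^ 2 := by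
  set A := Matrix.gram ℝ φ + lam • (1 : Matrix ι ι ℝ) with hA
  set k : ι → ℝ := fun i => inner ℝ (φ i) v with hk
  have hu : IsUnit A.det := (posDef_gram_add hlam φ).det_pos.ne'.isUnit
  set c := A⁻¹.mulVec k with hc
  have hAc : A.mulVec c = k := by
    rw [hc, Matrix.mulVec_mulVec, Matrix.mul_nonsing_inv _ hu, Matrix.one_mulVec]
  refine ⟨c, ?_⟩
  have h1 : c ⬝ᵥ A.mulVec c = ‖∑ i, c i • φ i‖ ^ 2 + lam * ∑ i, c i ^ 2 := by
    rw [hA, Matrix.add_mulVec, dotProduct_add, Matrix.smul_mulVec, Matrix.one_mulVec,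
      dotProduct_smul, ← real_inner_self_eq_norm_sq, sum_inner]
    congr 1
    · simp only [dotProduct, Matrix.mulVec, Matrix.gram_apply, inner_sum, real_inner_smul_left,
        real_inner_smul_right]
      refine Finset.sum_congr rfl fun i _ => ?_
      rw [Finset.mul_sum]
      refine Finset.sum_congr rfl fun j _ => by ring
    · simp [dotProduct, pow_two]
  have h2 : inner ℝ v (∑ i, c i • φ i) = k ⬝ᵥ c := by
    simp only [inner_sum, real_inner_smul_right, dotProduct, hk]
    exact Finset.sum_congr rfl fun i _ => by rw [real_inner_comm, mul_comm]
  have h3 : residual lam φ v = inner ℝ v v - k ⬝ᵥ c := rfl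
  rw [hAc, dotProduct_comm] at h1
  rw [h3, norm_sub_sq_real, h2, ← real_inner_self_eq_norm_sq v]
  linarith

lemma residual_nonneg {lam : ℝ} (hlam : 0 < lam) (φ : ι → E) (v : E) : 0 ≤ residual lam φ v := by
  obtain ⟨c, hc⟩ := residual_eq hlam φ v
  rw [hc]
  have := Finset.sum_nonneg (s := Finset.univ) fun i _ => sq_nonneg (c i)
  positivity

lemma residual_le {lam : ℝ} (hlam : 0 < lam) (φ : ι → E) (v : E) :
    residual lam φ v ≤ ‖v‖ ^ 2 := by
  have h := (posDef_gram_add hlam φ).inv.posSemidef.dotProduct_mulVec_nonneg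
    (fun i => inner ℝ (φ i) v)
  simp only [star_trivial] at h
  rw [residual, real_inner_self_eq_norm_sq]
  linarith

/-- The self-normalized Cauchy–Schwarz inequality. -/
lemma abs_inner_le_residual {lam : ℝ} (hlam : 0 < lam) (φ : ι → E) (v θ : E) :
    |inner ℝ θ v| ≤
      √(‖θ‖ ^ 2 + lam⁻¹ * ∑ i, (inner ℝ θ (φ i)) ^ 2) * √(residual lam φ v) := by
  obtain ⟨c, hc⟩ := residual_eq hlam φ v
  set w := v - ∑ i, c i • φ i with hw
  have hS : 0 ≤ ∑ i, c i ^ 2 := Finset.sum_nonneg fun i _ => sq_nonneg (c i)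
  have hD : 0 ≤ ∑ i, (inner ℝ θ (φ i)) ^ 2 := Finset.sum_nonneg fun i _ => sq_nonneg _
  -- Cauchy–Schwarz is applied to the ridge residual and to the fitted part separately; a weighted
  -- two-term Cauchy–Schwarz then joins them, with the defect written as a square in `h4`.
  have h1 : inner ℝ θ v = inner ℝ θ w + ∑ i, c i * inner ℝ θ (φ i) := by
    simp [hw, inner_sub_right, inner_sum, real_inner_smul_right]
  have h2 := abs_real_inner_le_norm θ w
  have h3 : |∑ i, c i * inner ℝ θ (φ i)| ≤ √(∑ i, c i ^ 2) * √(∑ i, (inner ℝ θ (φ i)) ^ 2) := by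
    rw [← Real.sqrt_mul hS]
    exact Real.abs_le_sqrt (Finset.sum_mul_sq_le_sq_mul_sq _ _ _)
  rw [← Real.sqrt_mul (by positivity), hc, h1]
  refine (abs_add_le _ _).trans ((add_le_add h2 h3).trans (Real.le_sqrt_of_sq_le ?_))
  set a := √(∑ i, c i ^ 2)
  set b := √(∑ i, (inner ℝ θ (φ i)) ^ 2)
  rw [← Real.sq_sqrt hS, ← Real.sq_sqrt hD]
  change (‖θ‖ * ‖w‖ + a * b) ^ 2 ≤ (‖θ‖ ^ 2 + lam⁻¹ * b ^ 2) * (‖w‖ ^ 2 + lam * a ^ 2)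
  have h4 : (‖θ‖ ^ 2 + lam⁻¹ * b ^ 2) * (‖w‖ ^ 2 + lam * a ^ 2) - (‖θ‖ * ‖w‖ + a * b) ^ 2
      = lam⁻¹ * (lam * ‖θ‖ * a - ‖w‖ * b) ^ 2 := by
    field_simp
    ring
  have h5 : 0 ≤ lam⁻¹ * (lam * ‖θ‖ * a - ‖w‖ * b) ^ 2 := by positivity
  linarith

/-- The Schur complement of the leading `n × n` block is the scalar `lam + residual`. -/
lemma det_gram_succ {lam : ℝ} (hlam : 0 < lam) {n : ℕ} (φ : ℕ → E) :
    (Matrix.gram ℝ (fun i : Fin (n + 1) => φ i) + lam • (1 : Matrix (Fin (n + 1)) _ ℝ)).det =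
      (Matrix.gram ℝ (fun i : Fin n => φ i) + lam • (1 : Matrix (Fin n) _ ℝ)).det *
        (lam + residual lam (fun i : Fin n => φ i) (φ n)) := by
  set A := Matrix.gram ℝ (fun i : Fin n => φ i) + lam • (1 : Matrix (Fin n) (Fin n) ℝ) with hA
  have hu : IsUnit A.det := (posDef_gram_add hlam _).det_pos.ne'.isUnit
  have hu' : IsUnit A := (Matrix.isUnit_iff_isUnit_det _).2 hu
  let := hu'.invertible
  rw [← Matrix.det_submatrix_equiv_self (finSumFinEquiv (m := n) (n := 1))]
  have h : (Matrix.gram ℝ (fun i : Fin (n + 1) => φ i) +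
      lam • (1 : Matrix (Fin (n + 1)) _ ℝ)).submatrix finSumFinEquiv finSumFinEquiv =
      Matrix.fromBlocks A (Matrix.of fun i _ => inner ℝ (φ i) (φ n))
        (Matrix.of fun _ i => inner ℝ (φ n) (φ i))
        (Matrix.of fun _ _ : Fin 1 => inner ℝ (φ n) (φ n) + lam) := by
    ext i j
    rcases i with i | i <;> rcases j with j | j
    · simp [hA, Matrix.gram_apply, Matrix.one_apply]
    · have : i ≠ n := by omega
      simp [Matrix.gram_apply, Matrix.one_apply, Fin.ext_iff]
      omega
    · simp [Matrix.gram_apply, Matrix.one_apply, Fin.ext_iff]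
      omega
    · simp [Matrix.gram_apply, Matrix.one_apply, Fin.ext_iff]
  rw [h, Matrix.det_fromBlocks₁₁]
  congr 1
  rw [Matrix.det_unique, Matrix.invOf_eq_nonsing_inv]
  simp only [Matrix.sub_apply, Matrix.of_apply, residual]
  rw [Matrix.mul_assoc, Matrix.mul_apply']
  have h1 : (fun i : Fin n => inner ℝ (φ n) (φ i)) = fun i : Fin n => inner ℝ (φ i) (φ n) := by
    ext i; exact real_inner_comm _ _
  have h2 : (fun j => (A⁻¹ * Matrix.of fun (i : Fin n) (_ : Fin 1) => inner ℝ (φ i) (φ n)) j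
      default) = A⁻¹.mulVec fun i : Fin n => inner ℝ (φ i) (φ n) := by
    ext j; simp [Matrix.mul_apply, Matrix.mulVec, dotProduct]
  have h3 : (Matrix.of fun (_ : Fin 1) (i : Fin n) => inner ℝ (φ n) (φ i)) default =
      fun i : Fin n => inner ℝ (φ i) (φ n) := by rw [← h1]; rfl
  rw [h2]
  simp only [h3]
  rw [hA]
  ring

/-- The information identity: the log determinant of the regularized Gram matrix is the sum of the
logarithmic residuals. -/
lemma log_det_gram {lam : ℝ} (hlam : 0 < lam) (φ : ℕ → E) (n : ℕ) :
    Real.log (1 + lam⁻¹ • Matrix.gram ℝ (fun i : Fin n => φ i)).det =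
      ∑ t ∈ Finset.range n,
        Real.log (1 + lam⁻¹ * residual lam (fun i : Fin t => φ i) (φ t)) := by
  have hs : ∀ n, (1 + lam⁻¹ • Matrix.gram ℝ (fun i : Fin n => φ i)) =
      lam⁻¹ • (Matrix.gram ℝ (fun i : Fin n => φ i) + lam • (1 : Matrix (Fin n) _ ℝ)) := by
    intro n
    rw [smul_add, smul_smul, inv_mul_cancel₀ hlam.ne', one_smul, add_comm]
  induction n with
  | zero => simp
  | succ n ih =>
    rw [Finset.sum_range_succ, ← ih, hs, hs, Matrix.det_smul, Matrix.det_smul, det_gram_succ hlam]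
    have h0 := residual_nonneg hlam (fun i : Fin n => φ i) (φ n)
    have hp := (posDef_gram_add hlam (fun i : Fin n => φ i)).det_pos
    rw [← Real.log_mul (by simp; exact ⟨fun h => absurd h hlam.ne', hp.ne'⟩) (by positivity)]
    congr 1
    simp only [Fintype.card_fin, pow_succ]
    field_simp

end GramResidual

/-! ### The additive kernel on pairs and the information gain. -/

section PairFeatures

variable {d : ℕ} {H : Type*} [NormedAddCommGroup H] [InnerProductSpace ℝ H] [CompleteSpace H]
  [RKHS ℝ H (EuclideanSpace ℝ (Fin d)) ℝ]

variable (H) in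
/-- The feature of a pair of points for the additive kernel. -/
def pairFeat (v : EuclideanSpace ℝ (Fin d) × EuclideanSpace ℝ (Fin d)) : WithLp 2 (H × H) :=
  WithLp.toLp 2 (feat H v.1, feat H v.2)

lemma inner_pairFeat (v w : EuclideanSpace ℝ (Fin d) × EuclideanSpace ℝ (Fin d)) :
    inner ℝ (pairFeat H v) (pairFeat H w) = pairKer H v w := by
  simp [pairFeat, WithLp.prod_inner_apply, inner_feat_feat, pairKer]

lemma pairGram_eq {n : ℕ} (w : Fin n → EuclideanSpace ℝ (Fin d) × EuclideanSpace ℝ (Fin d)) :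
    pairGram H w = Matrix.gram ℝ fun i => pairFeat H (w i) := by
  ext i j
  rw [Matrix.gram_apply, inner_pairFeat]; rfl

lemma pairSigma_eq (lam : ℝ) {n : ℕ}
    (w : Fin n → EuclideanSpace ℝ (Fin d) × EuclideanSpace ℝ (Fin d))
    (v : EuclideanSpace ℝ (Fin d) × EuclideanSpace ℝ (Fin d)) :
    pairSigma H lam w v = √(residual lam (fun i => pairFeat H (w i)) (pairFeat H v)) := by
  rw [pairSigma, residual, pairGram_eq]
  simp only [inner_pairFeat]

/-- This makes increments linear functionals on the feature space of the additive kernel, so that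
its uncertainty function controls preferences. -/
lemma inner_antidiag_pairFeat (h : H)
    (v : EuclideanSpace ℝ (Fin d) × EuclideanSpace ℝ (Fin d)) :
    inner ℝ (WithLp.toLp 2 (h, -h)) (pairFeat H v) = h v.1 - h v.2 := by
  simp [pairFeat, WithLp.prod_inner_apply, inner_feat_right, sub_eq_add_neg]

/-- The increments of a function of the RKHS are controlled by the uncertainty function. -/
lemma abs_sub_le_pairSigma {lam : ℝ} (hlam : 0 < lam) {n : ℕ}
    (w : Fin n → EuclideanSpace ℝ (Fin d) × EuclideanSpace ℝ (Fin d))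
    (v : EuclideanSpace ℝ (Fin d) × EuclideanSpace ℝ (Fin d)) (h : H) :
    |h v.1 - h v.2| ≤
      √(2 * ‖h‖ ^ 2 + lam⁻¹ * ∑ i, (h (w i).1 - h (w i).2) ^ 2) * pairSigma H lam w v := by
  have := abs_inner_le_residual hlam (fun i => pairFeat H (w i)) (pairFeat H v)
    (WithLp.toLp 2 (h, -h))
  simp only [inner_antidiag_pairFeat] at this
  rw [pairSigma_eq]
  have h2 : ‖(WithLp.toLp 2 (h, -h) : WithLp 2 (H × H))‖ ^ 2 = 2 * ‖h‖ ^ 2 := by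
    rw [WithLp.prod_norm_sq_eq_of_L2]
    simp; ring
  rwa [h2] at this

lemma norm_sq_pairFeat_le {X : Set (EuclideanSpace ℝ (Fin d))}
    (hker : ∀ a ∈ X, ∀ b ∈ X, ker H a b ≤ 1)
    {v : EuclideanSpace ℝ (Fin d) × EuclideanSpace ℝ (Fin d)} (h1 : v.1 ∈ X) (h2 : v.2 ∈ X) :
    ‖pairFeat H v‖ ^ 2 ≤ 2 := by
  rw [← real_inner_self_eq_norm_sq, inner_pairFeat, pairKer]
  linarith [hker _ h1 _ h1, hker _ h2 _ h2]

lemma stepSigma_nonneg (lam : ℝ) (x : ℕ → EuclideanSpace ℝ (Fin d)) (t : ℕ) :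
    0 ≤ stepSigma H lam x t := Real.sqrt_nonneg _

lemma det_one_add_gram_pos {E : Type*} [NormedAddCommGroup E] [InnerProductSpace ℝ E] {lam : ℝ}
    (hlam : 0 < lam) {n : ℕ} (φ : Fin n → E) :
    0 < (1 + lam⁻¹ • Matrix.gram ℝ φ).det :=
  (Matrix.PosDef.one.add_posSemidef
    ((Matrix.posSemidef_gram ℝ φ).smul (inv_pos.2 hlam).le)).det_pos

lemma continuous_pairKer (hk : Continuous fun p : EuclideanSpace ℝ (Fin d) ×
    EuclideanSpace ℝ (Fin d) => ker H p.1 p.2) :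
    Continuous fun p : (EuclideanSpace ℝ (Fin d) × EuclideanSpace ℝ (Fin d)) ×
      (EuclideanSpace ℝ (Fin d) × EuclideanSpace ℝ (Fin d)) => pairKer H p.1 p.2 := by
  have e1 := hk.comp ((continuous_fst.comp continuous_fst).prodMk
    (continuous_fst.comp continuous_snd) : Continuous fun p :
      (EuclideanSpace ℝ (Fin d) × EuclideanSpace ℝ (Fin d)) ×
      (EuclideanSpace ℝ (Fin d) × EuclideanSpace ℝ (Fin d)) => (p.1.1, p.2.1))
  have e2 := hk.comp ((continuous_snd.comp continuous_fst).prodMk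
    (continuous_snd.comp continuous_snd) : Continuous fun p :
      (EuclideanSpace ℝ (Fin d) × EuclideanSpace ℝ (Fin d)) ×
      (EuclideanSpace ℝ (Fin d) × EuclideanSpace ℝ (Fin d)) => (p.1.2, p.2.2))
  exact e1.add e2

/-- A real supremum is an upper bound only for a bounded family; here boundedness comes from
continuity of the log determinant on a compact space. -/
lemma le_infoGain {X : Set (EuclideanSpace ℝ (Fin d))} (hX : IsCompact X)
    (hk : Continuous fun p : EuclideanSpace ℝ (Fin d) × EuclideanSpace ℝ (Fin d) =>
      ker H p.1 p.2) {lam : ℝ} (hlam : 0 < lam) {T : ℕ}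
    (w : Fin T → EuclideanSpace ℝ (Fin d) × EuclideanSpace ℝ (Fin d))
    (hw : ∀ i, w i ∈ X ×ˢ X) :
    1 / 2 * Real.log (1 + lam⁻¹ • pairGram H w).det ≤ infoGain H X lam T := by
  have : CompactSpace (X ×ˢ X : Set (EuclideanSpace ℝ (Fin d) × EuclideanSpace ℝ (Fin d))) :=
    isCompact_iff_compactSpace.1 (hX.prod hX)
  have hc : Continuous fun w : Fin T → (X ×ˢ X :
      Set (EuclideanSpace ℝ (Fin d) × EuclideanSpace ℝ (Fin d))) =>
      1 / 2 * Real.log (1 + lam⁻¹ • pairGram H (fun i => (w i :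
        EuclideanSpace ℝ (Fin d) × EuclideanSpace ℝ (Fin d)))).det := by
    refine continuous_const.mul (Continuous.log ?_ fun w => ?_)
    · have hc : ∀ i : Fin T, Continuous fun w : Fin T → (X ×ˢ X :
          Set (EuclideanSpace ℝ (Fin d) × EuclideanSpace ℝ (Fin d))) =>
          (w i : EuclideanSpace ℝ (Fin d) × EuclideanSpace ℝ (Fin d)) := by fun_prop
      have hg : Continuous fun w : Fin T → (X ×ˢ X :
          Set (EuclideanSpace ℝ (Fin d) × EuclideanSpace ℝ (Fin d))) =>
          pairGram H (fun i => (w i : EuclideanSpace ℝ (Fin d) × EuclideanSpace ℝ (Fin d))) := by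
        refine continuous_matrix fun i j => ?_
        have := (continuous_pairKer hk).comp ((hc i).prodMk (hc j))
        simpa only [Function.comp_def, pairGram, Matrix.of_apply] using this
      exact Continuous.matrix_det (continuous_const.add (hg.const_smul lam⁻¹))
    · rw [pairGram_eq]
      exact (det_one_add_gram_pos hlam _).ne'
  exact le_ciSup (f := fun w : Fin T → (X ×ˢ X :
      Set (EuclideanSpace ℝ (Fin d) × EuclideanSpace ℝ (Fin d))) =>
      1 / 2 * Real.log (1 + lam⁻¹ • pairGram H (fun i => (w i :
        EuclideanSpace ℝ (Fin d) × EuclideanSpace ℝ (Fin d)))).det)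
    (isCompact_range hc).bddAbove fun i => ⟨w i, hw i⟩

/-- The sum of the squared uncertainties is controlled by the information gain. -/
lemma sum_stepSigma_sq_le {X : Set (EuclideanSpace ℝ (Fin d))} (hX : IsCompact X)
    (hker : ∀ a ∈ X, ∀ b ∈ X, ker H a b ≤ 1)
    (hk : Continuous fun p : EuclideanSpace ℝ (Fin d) × EuclideanSpace ℝ (Fin d) =>
      ker H p.1 p.2) {lam : ℝ} (hlam : 0 < lam) {T : ℕ}
    (x : ℕ → EuclideanSpace ℝ (Fin d)) (hx : ∀ t ≤ T, x t ∈ X) :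
    ∑ t ∈ Finset.Icc 1 T, stepSigma H lam x t ^ 2 ≤ 2 * (lam + 2) * infoGain H X lam T := by
  set φ : ℕ → WithLp 2 (H × H) := fun i => pairFeat H (x (i + 1), x i) with hφ
  have h1 := le_infoGain hX hk hlam (fun i : Fin T => (x (i + 1), x i))
    fun i => ⟨hx _ (by omega), hx _ (by omega)⟩
  rw [pairGram_eq, log_det_gram hlam φ T] at h1
  have h2 : ∑ t ∈ Finset.Icc 1 T, stepSigma H lam x t ^ 2 =
      ∑ t ∈ Finset.range T, residual lam (fun i : Fin t => φ i) (φ t) := by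
    have h0 : Finset.Icc 1 T = Finset.Ico (0 + 1) (T + 1) := by ext; simp
    rw [h0, ← Finset.sum_Ico_add' (fun t => stepSigma H lam x t ^ 2) 0 T 1, Finset.range_eq_Ico]
    refine Finset.sum_congr rfl fun t _ => ?_
    simp only [stepSigma, pairSigma_eq, Nat.add_sub_cancel]
    exact Real.sq_sqrt (residual_nonneg hlam _ _)
  rw [h2]
  -- With `u = r / lam`, the inequality `u / (1 + u) ≤ log (1 + u)` reads `r / (lam + r) ≤ log (1 +
  -- r / lam)`, and `r ≤ 2` because `k ≤ 1` on `X`.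
  have h3 : ∀ t ∈ Finset.range T, residual lam (fun i : Fin t => φ i) (φ t) ≤
      (lam + 2) * Real.log (1 + lam⁻¹ * residual lam (fun i : Fin t => φ i) (φ t)) := by
    intro t ht
    have ht' := Finset.mem_range.1 ht
    set r := residual lam (fun i : Fin t => φ i) (φ t)
    have hr0 : 0 ≤ r := residual_nonneg hlam _ _
    have hr2 : r ≤ 2 := (residual_le hlam _ _).trans
      (norm_sq_pairFeat_le hker (hx _ ht') (hx _ ht'.le))
    have h4 := Real.one_sub_inv_le_log_of_pos (x := 1 + lam⁻¹ * r) (by positivity)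
    have h5 : 1 - (1 + lam⁻¹ * r)⁻¹ = r / (lam + r) := by field_simp; ring
    rw [h5] at h4
    calc r = (lam + r) * (r / (lam + r)) := by field_simp
      _ ≤ (lam + 2) * (r / (lam + r)) := by gcongr
      _ ≤ _ := by gcongr
  calc _ ≤ _ := Finset.sum_le_sum h3
    _ = 2 * (lam + 2) * (1 / 2 * ∑ t ∈ Finset.range T,
        Real.log (1 + lam⁻¹ * residual lam (fun i : Fin t => φ i) (φ t))) := by
      rw [← Finset.mul_sum]; ring
    _ ≤ _ := by gcongr

end PairFeatures

/-! ### Curvature of the log-likelihood and its consequences for confidence sets. -/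

section Likelihood

/-- The softplus function `log (1 + e^u)`, an antiderivative of the logistic function. -/
def softplus (u : ℝ) : ℝ := -Real.log (1 - Real.sigmoid u)

lemma hasDerivAt_softplus (u : ℝ) : HasDerivAt softplus (Real.sigmoid u) u := by
  have h1 : 1 - Real.sigmoid u ≠ 0 := (sub_pos.2 (Real.sigmoid_lt_one u)).ne'
  have h := (((Real.hasDerivAt_sigmoid u).const_sub 1).log h1).neg
  exact h.congr_deriv (by field_simp)

/-- The curvature of the logistic link on `[-2B, 2B]`. -/
lemma dsigLow_le {B w : ℝ} (hw : |w| ≤ 2 * B) :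
    dsigLow B ≤ Real.sigmoid w * (1 - Real.sigmoid w) := by
  -- In this form the derivative of the link visibly decreases in `|w|`, and its value at `2 * B` is
  -- `dsigLow B`.
  have h1 : Real.sigmoid w * (1 - Real.sigmoid w) = 1 / (2 + 2 * Real.cosh w) := by
    rw [← Real.sigmoid_neg, Real.sigmoid_def, Real.sigmoid_def, neg_neg, Real.cosh_eq,
      ← mul_inv, one_div]
    congr 1
    have : Real.exp (-w) * Real.exp w = 1 := by rw [← Real.exp_add]; simp
    linear_combination this
  have h2 : dsigLow B = 1 / (2 + 2 * Real.cosh (2 * B)) := by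
    rw [dsigLow, Real.cosh_eq]
    congr 1
    rw [show -2 * B = -(2 * B) by ring]
    ring
  rw [h1, h2]
  have h3 : Real.cosh w ≤ Real.cosh (2 * B) := Real.cosh_le_cosh.2 (hw.trans (le_abs_self _))
  have := Real.cosh_pos w
  gcongr

lemma dsigLow_pos (B : ℝ) : 0 < dsigLow B := by rw [dsigLow]; positivity

/-- Strong convexity of the softplus function on `[-2B, 2B]`. -/
lemma softplus_strong_convex {B u v : ℝ} (hu : |u| ≤ 2 * B) (hv : |v| ≤ 2 * B) :
    dsigLow B / 2 * (v - u) ^ 2 ≤ softplus v - softplus u - Real.sigmoid u * (v - u) := by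
  set m := dsigLow B with hm
  -- Removing the quadratic leaves a function that is still convex on the interval; its tangent
  -- inequality at `u` is the claim.
  set F : ℝ → ℝ := fun w => softplus w - m / 2 * w ^ 2 with hF
  have hd : ∀ w, HasDerivAt F (Real.sigmoid w - m * w) w := fun w => by
    have h := (hasDerivAt_softplus w).sub ((hasDerivAt_pow 2 w).const_mul (m / 2))
    exact h.congr_deriv (by simp; ring)
  have hd1 : deriv F = fun w => Real.sigmoid w - m * w := funext fun w => (hd w).deriv
  have hd' : ∀ w, HasDerivAt (deriv F) (Real.sigmoid w * (1 - Real.sigmoid w) - m) w := fun w => by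
    rw [hd1]
    have h := (Real.hasDerivAt_sigmoid w).sub ((hasDerivAt_id w).const_mul m)
    exact h.congr_deriv (by simp)
  have hc : ConvexOn ℝ (Set.Icc (-(2 * B)) (2 * B)) F := by
    refine convexOn_of_deriv2_nonneg' (convex_Icc _ _)
      (fun w _ => (hd w).differentiableAt.differentiableWithinAt)
      (fun w _ => (hd' w).differentiableAt.differentiableWithinAt) fun w hw => ?_
    rw [Function.iterate_succ, Function.iterate_one, Function.comp_apply, (hd' w).deriv]
    exact sub_nonneg.2 (dsigLow_le (abs_le.2 hw))
  have key : (Real.sigmoid u - m * u) * (v - u) ≤ F v - F u := by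
    rcases lt_trichotomy u v with h | h | h
    · have := hc.le_slope_of_hasDerivAt (abs_le.1 hu) (abs_le.1 hv) h (hd u)
      rw [slope_def_field, le_div_iff₀ (sub_pos.2 h)] at this
      exact this
    · simp [h]
    · have := hc.slope_le_of_hasDerivAt (abs_le.1 hv) (abs_le.1 hu) h (hd u)
      rw [slope_def_field, div_le_iff₀ (sub_pos.2 h)] at this
      linarith
  simp only [hF] at key
  nlinarith

lemma abs_softplus_sub_sub_le (b : ℝ) (h0 : 0 ≤ b) (h1 : b ≤ 1) (u v : ℝ) :
    |(b * v - softplus v) - (b * u - softplus u)| ≤ |v - u| := by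
  have hd : ∀ w, HasDerivAt (fun w => b * w - softplus w) (b - Real.sigmoid w) w := fun w => by
    have h := ((hasDerivAt_id w).const_mul b).sub (hasDerivAt_softplus w)
    exact h.congr_deriv (by simp)
  have := convex_univ.norm_image_sub_le_of_norm_hasDerivWithin_le (C := 1)
    (fun w _ => (hd w).hasDerivWithinAt) (fun w _ => by
      rw [Real.norm_eq_abs, abs_le]
      constructor <;> linarith [Real.sigmoid_nonneg w, Real.sigmoid_le_one w])
    (Set.mem_univ u) (Set.mem_univ v)
  simpa using this

variable {d : ℕ} {H : Type*} [NormedAddCommGroup H] [InnerProductSpace ℝ H] [CompleteSpace H]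
  [RKHS ℝ H (EuclideanSpace ℝ (Fin d)) ℝ]

/-- A Boolean outcome as a real number. -/
def outcome (b : Bool) : ℝ := if b then 1 else 0

lemma outcome_nonneg (b : Bool) : 0 ≤ outcome b := by cases b <;> simp [outcome]

lemma outcome_le_one (b : Bool) : outcome b ≤ 1 := by cases b <;> simp [outcome]

omit [CompleteSpace H] in
-- Since `log σ(u) = u + log (1 - σ(u))`, the two outcomes merge into one expression affine in the
-- outcome, which isolates the martingale part.
lemma log_pairLik (g : H) (a a' : EuclideanSpace ℝ (Fin d)) (b : Bool) :
    Real.log (pairLik g a a' b) = outcome b * (g a - g a') - softplus (g a - g a') := by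
  set u := g a - g a' with hu
  cases b
  · simp [pairLik, outcome, softplus, hu]
  · have h1 : 0 < 1 - Real.sigmoid u := sub_pos.2 (Real.sigmoid_lt_one u)
    have h2 : Real.sigmoid u = Real.exp u * (1 - Real.sigmoid u) := by
      rw [← Real.sigmoid_neg, ← Real.sigmoid_mul_rexp_neg]
      have : Real.exp u * Real.exp (-u) = 1 := by rw [← Real.exp_add]; simp
      linear_combination -(Real.sigmoid u) * this
    have h3 : Real.log (Real.sigmoid u) = u + Real.log (1 - Real.sigmoid u) := by
      conv_lhs => rw [h2, Real.log_mul (Real.exp_pos _).ne' h1.ne', Real.log_exp]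
    simp [pairLik, outcome, softplus, ← hu, h3]

/-- The increment of `g` along the comparison of step `τ`. -/
def incr (x : ℕ → EuclideanSpace ℝ (Fin d)) (g : H) (τ : ℕ) : ℝ := g (x τ) - g (x (τ - 1))

/-- The centred score of `g` against `f`: the martingale part of the log-likelihood ratio. -/
def score (x : ℕ → EuclideanSpace ℝ (Fin d)) (y : ℕ → Bool) (f g : H) (t : ℕ) : ℝ :=
  ∑ τ ∈ Finset.Icc 1 t, (outcome (y τ) - Real.sigmoid (incr x f τ)) * (incr x g τ - incr x f τ)

omit [CompleteSpace H] in
lemma logLik_eq (x : ℕ → EuclideanSpace ℝ (Fin d)) (y : ℕ → Bool) (t : ℕ) (g : H) :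
    logLik x y t g =
      ∑ τ ∈ Finset.Icc 1 t, (outcome (y τ) * incr x g τ - softplus (incr x g τ)) := by
  simp only [logLik, log_pairLik, incr]

variable {X : Set (EuclideanSpace ℝ (Fin d))} {B : ℝ} {x : ℕ → EuclideanSpace ℝ (Fin d)}
  {y : ℕ → Bool} {T : ℕ}

lemma abs_incr_le (hker : ∀ a ∈ X, ∀ b ∈ X, ker H a b ≤ 1) (hx : ∀ t ≤ T, x t ∈ X) {g : H}
    (hg : ‖g‖ ≤ B) {τ : ℕ} (hτ : τ ≤ T) : |incr x g τ| ≤ 2 * B := by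
  have h1 := (abs_apply_le_norm (hker _ (hx τ hτ) _ (hx τ hτ)) g).trans hg
  have h' : x (τ - 1) ∈ X := hx _ ((Nat.sub_le _ _).trans hτ)
  have h2 := (abs_apply_le_norm (hker _ h' _ h') g).trans hg
  rw [incr]
  exact (abs_sub _ _).trans (by linarith)

/-- The log-likelihood ratio is its martingale part minus at least a quadratic term. -/
lemma logLik_sub_le (hker : ∀ a ∈ X, ∀ b ∈ X, ker H a b ≤ 1) (hx : ∀ t ≤ T, x t ∈ X) {f g : H}
    (hf : ‖f‖ ≤ B) (hg : ‖g‖ ≤ B) {t : ℕ} (ht : t ≤ T) :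
    logLik x y t g - logLik x y t f ≤ score x y f g t -
      dsigLow B / 2 * ∑ τ ∈ Finset.Icc 1 t, (incr x g τ - incr x f τ) ^ 2 := by
  rw [logLik_eq, logLik_eq, score, Finset.mul_sum, ← Finset.sum_sub_distrib,
    ← Finset.sum_sub_distrib]
  refine Finset.sum_le_sum fun τ hτ => ?_
  have hτ' : τ ≤ T := (Finset.mem_Icc.1 hτ).2.trans ht
  have := softplus_strong_convex (abs_incr_le hker hx hf hτ') (abs_incr_le hker hx hg hτ')
  linarith

omit [CompleteSpace H] in
lemma abs_incr_sub_le (hx : ∀ t ≤ T, x t ∈ X) {g h : H} {ε : ℝ}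
    (hgh : ∀ a ∈ X, |g a - h a| ≤ ε) {τ : ℕ} (hτ : τ ≤ T) :
    |incr x g τ - incr x h τ| ≤ 2 * ε := by
  have h1 := hgh _ (hx τ hτ)
  have h2 := hgh _ (hx _ ((Nat.sub_le τ 1).trans hτ))
  rw [incr, incr, show ∀ a b c d : ℝ, a - b - (c - d) = (a - c) - (b - d) by intros; ring]
  exact (abs_sub _ _).trans (by linarith)

omit [CompleteSpace H] in
lemma abs_logLik_sub_le (hx : ∀ t ≤ T, x t ∈ X) {g h : H} {ε : ℝ}
    (hgh : ∀ a ∈ X, |g a - h a| ≤ ε) {t : ℕ} (ht : t ≤ T) :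
    |logLik x y t g - logLik x y t h| ≤ 2 * ε * t := by
  rw [logLik_eq, logLik_eq, ← Finset.sum_sub_distrib]
  calc _ ≤ _ := Finset.abs_sum_le_sum_abs _ _
    _ ≤ ∑ τ ∈ Finset.Icc 1 t, 2 * ε := Finset.sum_le_sum fun τ hτ =>
        (abs_softplus_sub_sub_le _ (outcome_nonneg _) (outcome_le_one _) _ _).trans
          (abs_incr_sub_le hx hgh ((Finset.mem_Icc.1 hτ).2.trans ht))
    _ = 2 * ε * t := by simp; ring

/-- This lets the linear term of `beta1` pay for replacing a function by its net neighbour, which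
costs at most `2 * ε * t` in log-likelihood. -/
lemma two_le_constL {B : ℝ} (hB : 0 ≤ B) : 2 ≤ constL B := by
  have h : Real.exp (-2 * B) ≤ 1 := Real.exp_le_one_iff.2 (by linarith)
  have h2 : 1 ≤ 2 / (1 + Real.exp (-2 * B)) := by
    rw [le_div_iff₀ (by positivity)]
    linarith
  rw [constL]
  linarith

/-- The concentration event: along the run, the scores of all functions of the net are small. -/
def GoodScores (X : Set (EuclideanSpace ℝ (Fin d))) (B ε η : ℝ) (f : H) (T : ℕ) {n : ℕ}
    (N : Fin n → H) (x : ℕ → EuclideanSpace ℝ (Fin d)) (y : ℕ → Bool) : Prop :=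
  ∀ t ∈ Finset.Icc 1 T, ∀ i, score x y f (N i) t ≤
    √(32 * t * B ^ 2 * Real.log (Real.pi ^ 2 * t ^ 2 * coverNum H X B ε / (6 * η)))

variable {ε η : ℝ} {f : H} {n : ℕ} {N : Fin n → H}

/-- The quadratic term is dropped; the root in `beta1` pays for the score of the net neighbour. With
`g` the maximum likelihood estimate, this puts `f` in the confidence set. -/
lemma GoodScores.logLik_le (hG : GoodScores X B ε η f T N x y) (hB : 0 ≤ B) (hε : 0 ≤ ε)
    (hker : ∀ a ∈ X, ∀ b ∈ X, ker H a b ≤ 1) (hx : ∀ t ≤ T, x t ∈ X)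
    (hf : ‖f‖ ≤ B) (hN : ∀ i, ‖N i‖ ≤ B)
    (hcov : ∀ g : H, ‖g‖ ≤ B → ∃ i, ∀ a ∈ X, |g a - N i a| ≤ ε)
    {t : ℕ} (ht : t ∈ Finset.Icc 1 T) {g : H} (hg : ‖g‖ ≤ B) :
    logLik x y t g - beta1 H X B ε η t ≤ logLik x y t f := by
  obtain ⟨i, hi⟩ := hcov g hg
  have htT := (Finset.mem_Icc.1 ht).2
  have h1 := logLik_sub_le (y := y) hker hx hf (hN i) htT
  have h2 := abs_le.1 (abs_logLik_sub_le (y := y) hx hi htT)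
  have h3 := hG t ht i
  have h4 : 0 ≤ dsigLow B / 2 * ∑ τ ∈ Finset.Icc 1 t, (incr x (N i) τ - incr x f τ) ^ 2 :=
    mul_nonneg (by have := dsigLow_pos B; positivity) (Finset.sum_nonneg fun _ _ => sq_nonneg _)
  have h5 : 2 * ε * t ≤ constL B * ε * t := by gcongr; exact two_le_constL hB
  rw [beta1]
  linarith [h2.2]

omit [CompleteSpace H] in
lemma beta1_nonneg (hB : 0 ≤ B) (hε : 0 ≤ ε) (t : ℕ) : 0 ≤ beta1 H X B ε η t := by
  have := two_le_constL hB
  rw [beta1]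
  positivity

/-- Functions of the confidence set are close to `f` along the past comparisons. -/
lemma GoodScores.sum_sq_le (hG : GoodScores X B ε η f T N x y) (hB : 0 ≤ B) (hε : 0 ≤ ε)
    (hε1 : ε ≤ 1)
    (hker : ∀ a ∈ X, ∀ b ∈ X, ker H a b ≤ 1) (hx : ∀ t ≤ T, x t ∈ X)
    (hf : ‖f‖ ≤ B) (hN : ∀ i, ‖N i‖ ≤ B)
    (hcov : ∀ g : H, ‖g‖ ≤ B → ∃ i, ∀ a ∈ X, |g a - N i a| ≤ ε)
    {t : ℕ} (ht : t ≤ T) {m g : H} (hm : 1 ≤ t → IsMLE B x y t m)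
    (hg : g ∈ confSet X B ε η x y t m) :
    ∑ τ ∈ Finset.Icc 1 t, (incr x g τ - incr x f τ) ^ 2 ≤
      8 * (1 / dsigLow B + 1) * beta1 H X B ε η t := by
  have hb := beta1_nonneg (H := H) (X := X) (η := η) hB hε t
  have hm0 := dsigLow_pos B
  rcases Nat.eq_zero_or_pos t with rfl | ht1
  · simpa using mul_nonneg (by positivity) hb
  obtain ⟨hgB, hg2⟩ := hg
  obtain ⟨i, hi⟩ := hcov g hgB
  have h1 := logLik_sub_le (y := y) hker hx hf (hN i) ht
  have h2 := abs_le.1 (abs_logLik_sub_le (y := y) hx hi ht)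
  have h3 := hG t (Finset.mem_Icc.2 ⟨ht1, ht⟩) i
  have h5 : 2 * ε * t ≤ constL B * ε * t := by gcongr; exact two_le_constL hB
  have h6 := hg2 ht1
  have h7 := (hm ht1).2 f hf
  have hβ : beta1 H X B ε η t = √(32 * t * B ^ 2 *
    Real.log (Real.pi ^ 2 * t ^ 2 * coverNum H X B ε / (6 * η))) + constL B * ε * t := rfl
  set S := ∑ τ ∈ Finset.Icc 1 t, (incr x (N i) τ - incr x f τ) ^ 2
  have h8 : S ≤ 4 / dsigLow B * beta1 H X B ε η t := by
    -- One `beta1` is the slack of `g` against the estimate, hence against `f`; the other covers the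
    -- score and the passage to the net.
    have : dsigLow B / 2 * S ≤ 2 * beta1 H X B ε η t := by linarith [h2.2]
    rw [div_mul_eq_mul_div, le_div_iff₀ hm0]
    linarith
  -- Back from the net to `g` by `(a + b)² ≤ 2a² + 2b²` with `|b| ≤ 2ε`; as `ε ≤ 1`, the error is
  -- then absorbed by the linear term of `beta1`.
  have h9 : ∑ τ ∈ Finset.Icc 1 t, (incr x g τ - incr x f τ) ^ 2 ≤ 2 * S + 8 * ε ^ 2 * t := by
    calc _ ≤ ∑ τ ∈ Finset.Icc 1 t, (2 * (incr x (N i) τ - incr x f τ) ^ 2 + 8 * ε ^ 2) := by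
          refine Finset.sum_le_sum fun τ hτ => ?_
          have h := abs_incr_sub_le hx hi ((Finset.mem_Icc.1 hτ).2.trans ht)
          have h' := sq_le_sq' (abs_le.1 h).1 (abs_le.1 h).2
          nlinarith [sq_nonneg ((incr x g τ - incr x (N i) τ) - (incr x (N i) τ - incr x f τ))]
      _ = 2 * S + 8 * ε ^ 2 * t := by
          rw [Finset.sum_add_distrib, ← Finset.mul_sum]; simp; ring
  have h10 : ε ^ 2 * t ≤ ε * t := by
    gcongr
    nlinarith
  have h11 : 8 * ε ^ 2 * t ≤ 8 * beta1 H X B ε η t := by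
    have : 0 ≤ √(32 * t * B ^ 2 *
      Real.log (Real.pi ^ 2 * t ^ 2 * coverNum H X B ε / (6 * η))) := Real.sqrt_nonneg _
    have : 0 ≤ ε * t := by positivity
    linarith
  calc _ ≤ _ := h9
    _ ≤ 2 * (4 / dsigLow B * beta1 H X B ε η t) + 8 * beta1 H X B ε η t := by linarith
    _ = _ := by ring

end Likelihood

/-! ### Exponential supermartingale and Azuma–Hoeffding for Bernoulli outcomes. -/

section Concentration

/-- Hoeffding's lemma for a centred Bernoulli variable, with a weak constant. -/
lemma bernoulli_mgf_le {p v : ℝ} (h0 : 0 ≤ p) (h1 : p ≤ 1) :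
    p * Real.exp ((1 - p) * v) + (1 - p) * Real.exp (-p * v) ≤ Real.exp (v ^ 2 / 2) := by
  have hconv := convexOn_exp.2
  -- Both values of the centred variable are convex combinations of `v` and `-v`; averaging over the
  -- outcome gives each endpoint total weight `1/2`, hence `cosh v`.
  have e1 := @hconv v (Set.mem_univ v) (-v) (Set.mem_univ (-v)) ((2 - p) / 2) (p / 2)
    (by linarith) (by linarith) (by ring)
  have e2 := @hconv v (Set.mem_univ v) (-v) (Set.mem_univ (-v)) ((1 - p) / 2)
    ((1 + p) / 2) (by linarith) (by linarith) (by ring)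
  simp only [smul_eq_mul] at e1 e2
  rw [show (2 - p) / 2 * v + p / 2 * -v = (1 - p) * v by ring] at e1
  rw [show (1 - p) / 2 * v + (1 + p) / 2 * -v = -p * v by ring] at e2
  refine le_trans ?_ (Real.cosh_le_exp_half_sq v)
  rw [Real.cosh_eq]
  have := mul_le_mul_of_nonneg_left e1 h0
  have := mul_le_mul_of_nonneg_left e2 (sub_nonneg.2 h1)
  nlinarith

variable {Ω : Type*} {mΩ : MeasurableSpace Ω} {P : Measure Ω} [IsProbabilityMeasure P]

lemma measurable_outcome {m : MeasurableSpace Ω} {y : Ω → Bool} (hy : Measurable[m] y) :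
    Measurable[m] fun ω => outcome (y ω) :=
  (measurable_from_top (f := outcome)).comp hy

/-- One step of the exponential supermartingale. -/
lemma integral_mul_exp_le {m : MeasurableSpace Ω} (hm : m ≤ mΩ) {y : Ω → Bool} {W p D : Ω → ℝ}
    {c K : ℝ} (s : ℝ) (hW : Measurable[m] W) (hp : Measurable[m] p) (hD : Measurable[m] D)
    (hy : Measurable[mΩ] y) (hW0 : ∀ ω, 0 ≤ W ω) (hWK : ∀ ω, W ω ≤ K)
    (hp0 : ∀ ω, 0 ≤ p ω) (hp1 : ∀ ω, p ω ≤ 1) (hDc : ∀ ω, |D ω| ≤ c)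
    (hcond : P⟦{ω | y ω = true} | m⟧ =ᵐ[P] p) :
    ∫ ω, W ω * Real.exp (s * ((outcome (y ω) - p ω) * D ω)) ∂P ≤
      Real.exp (s ^ 2 * c ^ 2 / 2) * ∫ ω, W ω ∂P := by
  -- As the outcome is `0` or `1`, the integrand equals `U * I + V` with `U` and `V` known
  -- beforehand, so conditioning only has to replace the indicator `I` by `p`.
  set U : Ω → ℝ := fun ω => W ω * (Real.exp ((1 - p ω) * (s * D ω)) -
    Real.exp (-p ω * (s * D ω))) with hU
  set V : Ω → ℝ := fun ω => W ω * Real.exp (-p ω * (s * D ω)) with hV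
  set I : Ω → ℝ := {ω | y ω = true}.indicator fun _ => (1 : ℝ) with hI
  have hIo : ∀ ω, I ω = outcome (y ω) := fun ω => by
    cases h : y ω <;> simp [hI, outcome, h]
  have hUm : Measurable[m] U := by
    refine hW.mul (Measurable.sub ?_ ?_)
    · exact ((hp.const_sub 1).mul (hD.const_mul s)).exp
    · exact (hp.neg.mul (hD.const_mul s)).exp
  have hVm : Measurable[m] V := hW.mul (hp.neg.mul (hD.const_mul s)).exp
  have hE1 : ∀ ω, Real.exp ((1 - p ω) * (s * D ω)) ≤ Real.exp (|s| * c) := fun ω => by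
    refine Real.exp_le_exp.2 ((le_abs_self _).trans ?_)
    rw [abs_mul, abs_mul, abs_of_nonneg (sub_nonneg.2 (hp1 ω))]
    have h1 := hp0 ω
    have h2 := mul_le_mul_of_nonneg_left (hDc ω) (abs_nonneg s)
    have h3 : 0 ≤ |s| * |D ω| := by positivity
    nlinarith
  have hE2 : ∀ ω, Real.exp (-p ω * (s * D ω)) ≤ Real.exp (|s| * c) := fun ω => by
    refine Real.exp_le_exp.2 ((le_abs_self _).trans ?_)
    rw [abs_mul, abs_mul, abs_neg, abs_of_nonneg (hp0 ω)]
    have h1 := hp1 ω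
    have h2 := mul_le_mul_of_nonneg_left (hDc ω) (abs_nonneg s)
    have h3 : 0 ≤ |s| * |D ω| := by positivity
    nlinarith
  have hUb : ∀ ω, |U ω| ≤ K * Real.exp (|s| * c) := fun ω => by
    rw [hU]
    simp only [abs_mul, abs_of_nonneg (hW0 ω)]
    refine mul_le_mul (hWK ω) ?_ (abs_nonneg _) ((hW0 ω).trans (hWK ω))
    rw [abs_le]
    constructor <;> linarith [hE1 ω, hE2 ω, Real.exp_pos ((1 - p ω) * (s * D ω)),
      Real.exp_pos (-p ω * (s * D ω))]
  have hVb : ∀ ω, |V ω| ≤ K * Real.exp (|s| * c) := fun ω => by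
    rw [hV]
    simp only [abs_mul, abs_of_nonneg (hW0 ω), abs_of_pos (Real.exp_pos _)]
    exact mul_le_mul (hWK ω) (hE2 ω) (Real.exp_pos _).le ((hW0 ω).trans (hWK ω))
  have hIm : Measurable[mΩ] I := by
    have : I = fun ω => outcome (y ω) := funext hIo
    rw [this]
    exact measurable_outcome hy
  have hIi : Integrable I P := Integrable.of_bound hIm.aestronglyMeasurable 1
    (Filter.Eventually.of_forall fun ω => by
      rw [hIo, Real.norm_eq_abs, abs_of_nonneg (outcome_nonneg _)]; exact outcome_le_one _)
  have hUI : Integrable (U * I) P := Integrable.of_bound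
    ((hUm.mono hm le_rfl).mul hIm).aestronglyMeasurable (K * Real.exp (|s| * c))
    (Filter.Eventually.of_forall fun ω => by
      rw [Pi.mul_apply, Real.norm_eq_abs, abs_mul, hIo, abs_of_nonneg (outcome_nonneg _)]
      exact (mul_le_of_le_one_right (abs_nonneg _) (outcome_le_one _)).trans (hUb ω))
  have hUp : Integrable (U * p) P := Integrable.of_bound
    ((hUm.mul hp).mono hm le_rfl).aestronglyMeasurable (K * Real.exp (|s| * c))
    (Filter.Eventually.of_forall fun ω => by
      rw [Pi.mul_apply, Real.norm_eq_abs, abs_mul, abs_of_nonneg (hp0 ω)]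
      exact (mul_le_of_le_one_right (abs_nonneg _) (hp1 ω)).trans (hUb ω))
  have hVi : Integrable V P := Integrable.of_bound
    (hVm.mono hm le_rfl).aestronglyMeasurable (K * Real.exp (|s| * c))
    (Filter.Eventually.of_forall hVb)
  have hWi : Integrable W P := Integrable.of_bound
    (hW.mono hm le_rfl).aestronglyMeasurable K
    (Filter.Eventually.of_forall fun ω => by
      rw [Real.norm_eq_abs, abs_of_nonneg (hW0 ω)]; exact hWK ω)
  have hpull : ∫ ω, (U * I) ω ∂P = ∫ ω, (U * p) ω ∂P := by
    rw [← integral_condExp hm (f := U * I)]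
    refine integral_congr_ae ?_
    filter_upwards [condExp_mul_of_stronglyMeasurable_left hUm.stronglyMeasurable hUI hIi, hcond]
      with ω h1 h2
    rw [h1, Pi.mul_apply, Pi.mul_apply, h2]
  have hsplit : ∀ ω, W ω * Real.exp (s * ((outcome (y ω) - p ω) * D ω)) = (U * I) ω + V ω := by
    intro ω
    rw [Pi.mul_apply, hIo]
    cases y ω
    · simp only [outcome, hV, Bool.false_eq_true, if_false]
      rw [mul_zero, zero_add]
      ring_nf
    · simp only [outcome, hU, hV, if_true]
      rw [show s * ((1 - p ω) * D ω) = (1 - p ω) * (s * D ω) by ring]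
      ring
  calc ∫ ω, W ω * Real.exp (s * ((outcome (y ω) - p ω) * D ω)) ∂P
      = ∫ ω, ((U * I) ω + V ω) ∂P := by simp_rw [hsplit]
    _ = ∫ ω, ((U * p) ω + V ω) ∂P := by
        rw [integral_add hUI hVi, integral_add hUp hVi, hpull]
    _ ≤ ∫ ω, Real.exp (s ^ 2 * c ^ 2 / 2) * W ω ∂P := by
        refine integral_mono (hUp.add hVi) (hWi.const_mul _) fun ω => ?_
        have h1 := bernoulli_mgf_le (v := s * D ω) (hp0 ω) (hp1 ω)
        have h2 : Real.exp ((s * D ω) ^ 2 / 2) ≤ Real.exp (s ^ 2 * c ^ 2 / 2) := by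
          rw [mul_pow]
          have : D ω ^ 2 ≤ c ^ 2 := sq_le_sq' (abs_le.1 (hDc ω)).1 (abs_le.1 (hDc ω)).2
          gcongr
        have h3 := mul_le_mul_of_nonneg_left (h1.trans h2) (hW0 ω)
        simp only [Pi.mul_apply, hU, hV]
        linarith
    _ = _ := integral_const_mul _ _

/-- The data of a martingale of centred Bernoulli outcomes with predictable bounded weights. -/
structure IsScore (P : Measure Ω) (ℱ : Filtration ℕ mΩ) (T : ℕ) (c : ℝ) (y : ℕ → Ω → Bool)
    (p D : ℕ → Ω → ℝ) : Prop where
  meas_y : ∀ t ∈ Finset.Icc 1 T, Measurable[ℱ t] (y t)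
  meas_p : ∀ t ∈ Finset.Icc 1 T, Measurable[ℱ (t - 1)] (p t)
  meas_D : ∀ t ∈ Finset.Icc 1 T, Measurable[ℱ (t - 1)] (D t)
  p_nonneg : ∀ t ∈ Finset.Icc 1 T, ∀ ω, 0 ≤ p t ω
  p_le_one : ∀ t ∈ Finset.Icc 1 T, ∀ ω, p t ω ≤ 1
  abs_D_le : ∀ t ∈ Finset.Icc 1 T, ∀ ω, |D t ω| ≤ c
  cond : ∀ t ∈ Finset.Icc 1 T, P⟦{ω | y t ω = true} | ℱ (t - 1)⟧ =ᵐ[P] p t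

/-- The sum of the weighted centred outcomes. -/
def scoreSum (y : ℕ → Ω → Bool) (p D : ℕ → Ω → ℝ) (t : ℕ) (ω : Ω) : ℝ :=
  ∑ τ ∈ Finset.Icc 1 t, (outcome (y τ ω) - p τ ω) * D τ ω

variable {ℱ : Filtration ℕ mΩ} {T : ℕ} {c : ℝ} {y : ℕ → Ω → Bool} {p D : ℕ → Ω → ℝ}

omit [IsProbabilityMeasure P] in
lemma IsScore.measurable_scoreSum (h : IsScore P ℱ T c y p D) {t : ℕ} (ht : t ≤ T) :
    Measurable[ℱ t] (scoreSum y p D t) := by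
  refine Finset.measurable_fun_sum _ fun τ hτ => ?_
  have hτ' := Finset.mem_Icc.1 hτ
  have hτT : τ ∈ Finset.Icc 1 T := Finset.mem_Icc.2 ⟨hτ'.1, hτ'.2.trans ht⟩
  have hle : τ - 1 ≤ t := (Nat.sub_le _ _).trans hτ'.2
  exact ((measurable_outcome ((h.meas_y τ hτT).mono (ℱ.mono hτ'.2) le_rfl)).sub
    ((h.meas_p τ hτT).mono (ℱ.mono hle) le_rfl)).mul
      ((h.meas_D τ hτT).mono (ℱ.mono hle) le_rfl)

omit [IsProbabilityMeasure P] in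
lemma IsScore.abs_scoreSum_le (h : IsScore P ℱ T c y p D) {t : ℕ} (ht : t ≤ T) (ω : Ω) :
    |scoreSum y p D t ω| ≤ t * c := by
  calc _ ≤ _ := Finset.abs_sum_le_sum_abs _ _
    _ ≤ ∑ τ ∈ Finset.Icc 1 t, c := Finset.sum_le_sum fun τ hτ => by
        have hτ' := Finset.mem_Icc.1 hτ
        have hτT : τ ∈ Finset.Icc 1 T := Finset.mem_Icc.2 ⟨hτ'.1, hτ'.2.trans ht⟩
        rw [abs_mul]
        refine (mul_le_of_le_one_left (abs_nonneg _) ?_).trans (h.abs_D_le τ hτT ω)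
        rw [abs_le]
        constructor <;> linarith [h.p_nonneg τ hτT ω, h.p_le_one τ hτT ω,
          outcome_nonneg (y τ ω), outcome_le_one (y τ ω)]
    _ = t * c := by simp

omit [IsProbabilityMeasure P] in
lemma IsScore.exp_scoreSum_le (h : IsScore P ℱ T c y p D) (s : ℝ) {t : ℕ} (ht : t ≤ T) (ω : Ω) :
    Real.exp (s * scoreSum y p D t ω) ≤ Real.exp (|s| * (t * c)) := by
  refine Real.exp_le_exp.2 ((le_abs_self _).trans ?_)
  rw [abs_mul]
  exact mul_le_mul_of_nonneg_left (h.abs_scoreSum_le ht ω) (abs_nonneg s)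

lemma IsScore.integral_exp_le (h : IsScore P ℱ T c y p D) (s : ℝ) {t : ℕ} (ht : t ≤ T) :
    ∫ ω, Real.exp (s * scoreSum y p D t ω) ∂P ≤ Real.exp (t * (s ^ 2 * c ^ 2 / 2)) := by
  induction t with
  | zero => simp [scoreSum]
  | succ t ih =>
    have hmem : t + 1 ∈ Finset.Icc 1 T := Finset.mem_Icc.2 ⟨by omega, ht⟩
    have ht' : t ≤ T := by omega
    have hstep := integral_mul_exp_le (ℱ.le t) s
      (((h.measurable_scoreSum ht').const_mul s).exp) (h.meas_p _ hmem) (h.meas_D _ hmem)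
      ((h.meas_y _ hmem).mono (ℱ.le _) le_rfl) (fun ω => (Real.exp_pos _).le)
      (h.exp_scoreSum_le s ht') (h.p_nonneg _ hmem) (h.p_le_one _ hmem) (h.abs_D_le _ hmem)
      (h.cond _ hmem)
    have hs : ∀ ω, Real.exp (s * scoreSum y p D (t + 1) ω) =
        Real.exp (s * scoreSum y p D t ω) *
          Real.exp (s * ((outcome (y (t + 1) ω) - p (t + 1) ω) * D (t + 1) ω)) := fun ω => by
      rw [← Real.exp_add, scoreSum, Finset.sum_Icc_succ_top (by omega), mul_add]
      rfl
    simp_rw [hs]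
    refine hstep.trans ((mul_le_mul_of_nonneg_left (ih ht') (Real.exp_pos _).le).trans ?_)
    rw [← Real.exp_add]
    refine Real.exp_le_exp.2 (le_of_eq ?_)
    push_cast
    ring

/-- The Azuma–Hoeffding tail bound. -/
lemma IsScore.tail (h : IsScore P ℱ T c y p D) (hc : 0 < c) {t : ℕ} (ht : t ∈ Finset.Icc 1 T)
    {L : ℝ} (hL : 1 < L) :
    P.real {ω | √(2 * t * c ^ 2 * Real.log L) < scoreSum y p D t ω} ≤ L⁻¹ := by
  obtain ⟨ht1, htT⟩ := Finset.mem_Icc.1 ht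
  have ht0 : (0 : ℝ) < t := by exact_mod_cast ht1
  have hl := Real.log_pos hL
  set a := √(2 * t * c ^ 2 * Real.log L) with ha
  have ha2 : a ^ 2 = 2 * t * c ^ 2 * Real.log L := Real.sq_sqrt (by positivity)
  -- The minimizer of the Chernoff exponent `-s * a + t * s² * c² / 2`.
  set s := a / (t * c ^ 2) with hs
  have hs0 : 0 ≤ s := by positivity
  have hm : Measurable (scoreSum y p D t) := (h.measurable_scoreSum htT).mono (ℱ.le _) le_rfl
  have hint : Integrable (fun ω => Real.exp (s * scoreSum y p D t ω)) P :=
    Integrable.of_bound (hm.const_mul s).exp.aestronglyMeasurable _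
      (Filter.Eventually.of_forall fun ω => by
        rw [Real.norm_eq_abs, abs_of_pos (Real.exp_pos _)]; exact h.exp_scoreSum_le s htT ω)
  calc _ ≤ P.real {ω | a ≤ scoreSum y p D t ω} :=
        measureReal_mono fun ω (hω : a < _) => hω.le
    _ ≤ Real.exp (-s * a) * mgf (scoreSum y p D t) P s := measure_ge_le_exp_mul_mgf a hs0 hint
    _ ≤ Real.exp (-s * a) * Real.exp (t * (s ^ 2 * c ^ 2 / 2)) := by
        gcongr
        exact h.integral_exp_le s htT
    _ = Real.exp (-Real.log L) := by
        rw [← Real.exp_add]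
        congr 1
        have h1 : -s * a + t * (s ^ 2 * c ^ 2 / 2) = -a ^ 2 / (2 * t * c ^ 2) := by
          rw [hs]; field_simp; ring
        rw [h1, ha2]
        field_simp
    _ = L⁻¹ := by rw [Real.exp_neg, Real.exp_log (by linarith)]

end Concentration

/-! ### Probability of the concentration event. -/

section Event

variable {d : ℕ} {H : Type*} [NormedAddCommGroup H] [InnerProductSpace ℝ H] [CompleteSpace H]
  [RKHS ℝ H (EuclideanSpace ℝ (Fin d)) ℝ] {X : Set (EuclideanSpace ℝ (Fin d))} {B ε η : ℝ}
  {Ω : Type*} {mΩ : MeasurableSpace Ω} {P : Measure Ω} [IsProbabilityMeasure P]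
  {ℱ : Filtration ℕ mΩ} {f : H} {T : ℕ} {x : ℕ → Ω → EuclideanSpace ℝ (Fin d)}
  {y : ℕ → Ω → Bool} {mle opt : ℕ → Ω → H}

omit [IsProbabilityMeasure P] in
lemma IsRun.measurable_incr (h : IsRun P ℱ X B ε η f T x y mle opt)
    (hk : Continuous fun p : EuclideanSpace ℝ (Fin d) × EuclideanSpace ℝ (Fin d) =>
      ker H p.1 p.2) (g : H) {t : ℕ} (ht : t ∈ Finset.Icc 1 T) :
    Measurable[ℱ (t - 1)] fun ω => incr (x · ω) g t := by
  obtain ⟨ht1, htT⟩ := Finset.mem_Icc.1 ht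
  have hg := (continuous_coe hk g).measurable
  have h1 : Measurable[ℱ (t - 1)] (x (t - 1)) := by
    rcases Nat.eq_zero_or_pos (t - 1) with h0 | h0
    · rw [h0]; exact h.meas_init
    · exact (h.meas_point _ (Finset.mem_Icc.2 ⟨h0, by omega⟩)).mono (ℱ.mono (Nat.sub_le _ _)) le_rfl
  exact (hg.comp (h.meas_point t ht)).sub (hg.comp h1)

omit [IsProbabilityMeasure P] in
lemma IsRun.isScore (h : IsRun P ℱ X B ε η f T x y mle opt)
    (hker : ∀ a ∈ X, ∀ b ∈ X, ker H a b ≤ 1)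
    (hk : Continuous fun p : EuclideanSpace ℝ (Fin d) × EuclideanSpace ℝ (Fin d) =>
      ker H p.1 p.2) (hf : ‖f‖ ≤ B) {g : H} (hg : ‖g‖ ≤ B) :
    IsScore P ℱ T (4 * B) y (fun t ω => Real.sigmoid (incr (x · ω) f t))
      (fun t ω => incr (x · ω) g t - incr (x · ω) f t) where
  meas_y := h.meas_outcome
  meas_p t ht := continuous_sigmoid.measurable.comp (h.measurable_incr hk f ht)
  meas_D t ht := (h.measurable_incr hk g ht).sub (h.measurable_incr hk f ht)
  p_nonneg _ _ _ := Real.sigmoid_nonneg _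
  p_le_one _ _ _ := Real.sigmoid_le_one _
  abs_D_le t ht ω := by
    have htT := (Finset.mem_Icc.1 ht).2
    have h1 := abs_incr_le (x := (x · ω)) hker (fun t ht => h.mem t ht ω) hf htT
    have h2 := abs_incr_le (x := (x · ω)) hker (fun t ht => h.mem t ht ω) hg htT
    exact (abs_sub _ _).trans (by linarith)
  cond := h.oracle

lemma sum_inv_sq_le (T : ℕ) : ∑ t ∈ Finset.Icc 1 T, 1 / (t : ℝ) ^ 2 ≤ Real.pi ^ 2 / 6 := by
  rw [← hasSum_zeta_two.tsum_eq]
  exact hasSum_zeta_two.summable.sum_le_tsum _ fun _ _ => by positivity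

/-- The argument of the logarithms in the confidence parameters is bounded away from one. -/
lemma le_log_arg {t N : ℕ} (ht : 1 ≤ t) (hN : 1 ≤ N) (hη0 : 0 < η) (hη1 : η ≤ 1) :
    3 / 2 ≤ Real.pi ^ 2 * t ^ 2 * N / (6 * η) := by
  have h1 : (1 : ℝ) ≤ t := by exact_mod_cast ht
  have h2 : (1 : ℝ) ≤ N := by exact_mod_cast hN
  have h3 := Real.pi_gt_three
  rw [le_div_iff₀ (by positivity)]
  have h4 : (9 : ℝ) ≤ Real.pi ^ 2 := by nlinarith
  have h5 : 1 ≤ (t : ℝ) ^ 2 := one_le_pow₀ h1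
  have h6 : (9 : ℝ) * 1 * 1 ≤ Real.pi ^ 2 * t ^ 2 * N := by gcongr
  linarith

/-- A union bound: each time and net point fails with probability at most `(L t)⁻¹ = 6η / (π² t²
𝒩)`; summing over the net cancels the covering number `𝒩`, and `∑ 1 / t² = π² / 6` leaves `η`. -/
lemma IsRun.measure_not_good_le (h : IsRun P ℱ X B ε η f T x y mle opt)
    (hker : ∀ a ∈ X, ∀ b ∈ X, ker H a b ≤ 1)
    (hk : Continuous fun p : EuclideanSpace ℝ (Fin d) × EuclideanSpace ℝ (Fin d) =>
      ker H p.1 p.2) (hf : ‖f‖ ≤ B) (hB : 0 < B) (hη0 : 0 < η) (hη1 : η ≤ 1)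
    (hc1 : 1 ≤ coverNum H X B ε) {N : Fin (coverNum H X B ε) → H} (hN : ∀ i, ‖N i‖ ≤ B) :
    P.real {ω | ¬ GoodScores X B ε η f T N (x · ω) (y · ω)} ≤ η := by
  set L : ℕ → ℝ := fun t => Real.pi ^ 2 * t ^ 2 * coverNum H X B ε / (6 * η) with hLdef
  have hsub : {ω | ¬ GoodScores X B ε η f T N (x · ω) (y · ω)} ⊆
      ⋃ t ∈ Finset.Icc 1 T, ⋃ i ∈ (Finset.univ : Finset (Fin (coverNum H X B ε))),
        {ω | √(2 * t * (4 * B) ^ 2 * Real.log (L t)) <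
          scoreSum y (fun t ω => Real.sigmoid (incr (x · ω) f t))
            (fun t ω => incr (x · ω) (N i) t - incr (x · ω) f t) t ω} := by
    intro ω hω
    simp only [GoodScores, Set.mem_ofPred_eq, not_forall, not_le] at hω
    obtain ⟨t, ht, i, hi⟩ := hω
    simp only [Set.mem_iUnion]
    refine ⟨t, ht, i, Finset.mem_univ _, ?_⟩
    -- The constant `32` of `beta1` is that of the tail bound with weights at most `4 * B`, a
    -- difference of two increments bounded by `2 * B`.
    have e : 2 * (t : ℝ) * (4 * B) ^ 2 = 32 * t * B ^ 2 := by ring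
    rw [Set.mem_ofPred_eq, e]
    exact hi
  have hn0 : (0 : ℝ) < coverNum H X B ε := by exact_mod_cast hc1
  refine (measureReal_mono hsub (measure_ne_top P _)).trans ?_
  calc _ ≤ ∑ t ∈ Finset.Icc 1 T, ∑ _i : Fin (coverNum H X B ε), (L t)⁻¹ := by
        refine (measureReal_biUnion_finset_le _ _).trans (Finset.sum_le_sum fun t ht => ?_)
        refine (measureReal_biUnion_finset_le _ _).trans (Finset.sum_le_sum fun i _ => ?_)
        refine (h.isScore hker hk hf (hN i)).tail (by linarith) ht ?_
        exact lt_of_lt_of_le (by norm_num) (le_log_arg (Finset.mem_Icc.1 ht).1 hc1 hη0 hη1)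
    _ = 6 * η / Real.pi ^ 2 * ∑ t ∈ Finset.Icc 1 T, 1 / (t : ℝ) ^ 2 := by
        rw [Finset.mul_sum]
        refine Finset.sum_congr rfl fun t ht => ?_
        have : (0 : ℝ) < t := by exact_mod_cast (Finset.mem_Icc.1 ht).1
        simp only [Finset.sum_const, Finset.card_univ, Fintype.card_fin, nsmul_eq_mul, hLdef]
        field_simp
    _ ≤ 6 * η / Real.pi ^ 2 * (Real.pi ^ 2 / 6) := by
        gcongr
        exact sum_inv_sq_le T
    _ = η := by have := Real.pi_pos; field_simp

end Event

/-! ### Monotonicity and comparison of the confidence parameters. -/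

section Confidence

variable {d : ℕ} {H : Type*} [NormedAddCommGroup H] [InnerProductSpace ℝ H] [CompleteSpace H]
  [RKHS ℝ H (EuclideanSpace ℝ (Fin d)) ℝ] {X : Set (EuclideanSpace ℝ (Fin d))} {B ε η : ℝ}

lemma sqrt_mul_log_mono {k b s t u v : ℝ} (hk : 0 ≤ k) (hs : 0 ≤ s) (hst : s ≤ t) (hu : 1 ≤ u)
    (huv : u ≤ v) : √(k * s * b ^ 2 * Real.log u) ≤ √(k * t * b ^ 2 * Real.log v) := by
  refine Real.sqrt_le_sqrt (mul_le_mul ?_ (Real.log_le_log (by linarith) huv)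
    (Real.log_nonneg hu) ?_)
  · gcongr
  · have := hs.trans hst
    positivity

/-- For `u ≥ 3/2` one has `2u ≤ u³`, so doubling the argument at most triples the logarithm. This is
the cost of halving `δ`: the widths use `δ / 2`, the final bound `δ`. -/
lemma sqrt_mul_log_two_mul_le {k b t u : ℝ} (hk : 0 ≤ k) (ht : 0 ≤ t) (hu : 3 / 2 ≤ u) :
    √(k * t * b ^ 2 * Real.log (2 * u)) ≤ 2 * √(k * t * b ^ 2 * Real.log u) := by
  have h0 : 0 ≤ Real.log u := Real.log_nonneg (by linarith)
  have h1 : Real.log (2 * u) ≤ 2 ^ 2 * Real.log u := by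
    have h2 : Real.log (2 * u) ≤ Real.log (u ^ 3) :=
      Real.log_le_log (by linarith) (by nlinarith [mul_le_mul hu hu (by norm_num) (by linarith)])
    rw [Real.log_pow] at h2
    push_cast at h2
    linarith
  calc _ ≤ √(2 ^ 2 * (k * t * b ^ 2 * Real.log u)) := by
        refine Real.sqrt_le_sqrt ?_
        have : 0 ≤ k * t * b ^ 2 := by positivity
        nlinarith [mul_le_mul_of_nonneg_left h1 this]
    _ = _ := by rw [Real.sqrt_mul (by positivity), Real.sqrt_sq (by norm_num)]

lemma le_log_arg' {t N : ℕ} (ht : 1 ≤ t) (hN : 1 ≤ N) (hη0 : 0 < η) (hη1 : η ≤ 1) :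
    3 / 2 ≤ Real.pi ^ 2 * t ^ 2 * N / (3 * η) := by
  have := le_log_arg (η := η / 2) ht hN (by linarith) (by linarith)
  rwa [show 6 * (η / 2) = 3 * η by ring] at this

lemma constL_nonneg (hB : 0 ≤ B) : 0 ≤ constL B := zero_le_two.trans (two_le_constL hB)

lemma constH_pos (B : ℝ) : 0 < constH B := by
  rw [constH, sigUp]
  positivity

/-- The scale of the confidence parameter `β`. -/
def betaScale (B : ℝ) : ℝ := dsigLow B ^ 2 / constH B

lemma betaScale_pos (B : ℝ) : 0 < betaScale B := by
  have := dsigLow_pos B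
  have := constH_pos B
  rw [betaScale]
  positivity

omit [CompleteSpace H] in
lemma beta_eq (t : ℕ) : beta H X B ε η t =
    betaScale B * (beta2 H X B ε η t + 2 * beta1 H X B ε η t) := rfl

omit [CompleteSpace H] in
lemma le_beta2 (t : ℕ) : 2 * constL B * ε * t ≤ beta2 H X B ε η t := by
  have := (constH_pos B).le
  have h1 : 0 ≤ 8 * constH B * dsigUp ^ 2 * ε ^ 2 * t := by positivity
  rw [beta2]
  linarith [Real.sqrt_nonneg (8 * t * constBp B ^ 2 *
        Real.log (Real.pi ^ 2 * t ^ 2 * coverNum H X B ε / (3 * η)))]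

omit [CompleteSpace H] in
lemma beta1_mono (hB : 0 ≤ B) (hε : 0 ≤ ε) (hη0 : 0 < η) (hη1 : η ≤ 1)
    (hN : 1 ≤ coverNum H X B ε) {s t : ℕ} (hst : s ≤ t) :
    beta1 H X B ε η s ≤ beta1 H X B ε η t := by
  -- The value `s = 0` occurs at the first step of a run, where no comparison is available; the
  -- logarithm bounds need `s ≥ 1`.
  rcases Nat.eq_zero_or_pos s with rfl | hs
  · have : beta1 H X B ε η 0 = 0 := by simp [beta1]
    rw [this]
    exact beta1_nonneg hB hε t
  have hL := constL_nonneg hB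
  have h1 : (s : ℝ) ≤ t := by exact_mod_cast hst
  refine add_le_add (sqrt_mul_log_mono (by norm_num) (by positivity) h1 ?_ ?_) (by gcongr)
  · linarith [le_log_arg (N := coverNum H X B ε) hs hN hη0 hη1]
  · gcongr

omit [CompleteSpace H] in
lemma beta2_mono (hB : 0 ≤ B) (hε : 0 ≤ ε) (hη0 : 0 < η) (hη1 : η ≤ 1)
    (hN : 1 ≤ coverNum H X B ε) {s t : ℕ} (hs : 1 ≤ s) (hst : s ≤ t) :
    beta2 H X B ε η s ≤ beta2 H X B ε η t := by
  have hL := constL_nonneg hB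
  have hH := (constH_pos B).le
  have h1 : (s : ℝ) ≤ t := by exact_mod_cast hst
  refine add_le_add (by gcongr) (sqrt_mul_log_mono (by norm_num) (by positivity) h1 ?_ ?_)
  · linarith [le_log_arg' (N := coverNum H X B ε) hs hN hη0 hη1]
  · gcongr

omit [CompleteSpace H] in
lemma beta_mono (hB : 0 ≤ B) (hε : 0 ≤ ε) (hη0 : 0 < η) (hη1 : η ≤ 1)
    (hN : 1 ≤ coverNum H X B ε) {s t : ℕ} (hs : 1 ≤ s) (hst : s ≤ t) :
    beta H X B ε η s ≤ beta H X B ε η t := by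
  rw [beta_eq, beta_eq]
  have := (betaScale_pos B).le
  have := beta1_mono hB hε hη0 hη1 hN hst
  have := beta2_mono hB hε hη0 hη1 hN hs hst
  gcongr

omit [CompleteSpace H] in
lemma beta_half_le (hB : 0 ≤ B) (hε : 0 ≤ ε) (hη0 : 0 < η) (hη1 : η ≤ 1)
    (hN : 1 ≤ coverNum H X B ε) {t : ℕ} (ht : 1 ≤ t) :
    beta H X B ε (η / 2) t ≤ 2 * beta H X B ε η t := by
  have hL := constL_nonneg hB
  have hH := (constH_pos B).le
  have e1 := sqrt_mul_log_two_mul_le (k := 32) (b := B) (t := t) (by norm_num) (by positivity)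
    (le_log_arg (N := coverNum H X B ε) ht hN hη0 hη1)
  have e2 := sqrt_mul_log_two_mul_le (k := 8) (b := constBp B) (t := t) (by norm_num)
    (by positivity) (le_log_arg' (N := coverNum H X B ε) ht hN hη0 hη1)
  have r1 : 2 * (Real.pi ^ 2 * t ^ 2 * coverNum H X B ε / (6 * η)) =
      Real.pi ^ 2 * t ^ 2 * coverNum H X B ε / (6 * (η / 2)) := by field_simp
  have r2 : 2 * (Real.pi ^ 2 * t ^ 2 * coverNum H X B ε / (3 * η)) =
      Real.pi ^ 2 * t ^ 2 * coverNum H X B ε / (3 * (η / 2)) := by field_simp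
  rw [r1] at e1
  rw [r2] at e2
  have p1 : 0 ≤ constL B * ε * t := by positivity
  have p2 : 0 ≤ constH B * dsigUp ^ 2 * ε ^ 2 * t := by positivity
  have b1 : beta1 H X B ε (η / 2) t ≤ 2 * beta1 H X B ε η t := by
    simp only [beta1]
    linarith
  have b2 : beta2 H X B ε (η / 2) t ≤ 2 * beta2 H X B ε η t := by
    simp only [beta2]
    linarith
  rw [beta_eq, beta_eq]
  have := mul_le_mul_of_nonneg_left (add_le_add b2 (mul_le_mul_of_nonneg_left b1 zero_le_two))
    (betaScale_pos B).le
  linarith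

omit [CompleteSpace H] in
lemma beta1_le_beta (hB : 0 ≤ B) (hε : 0 ≤ ε) (t : ℕ) :
    beta1 H X B ε η t ≤ beta H X B ε η t / betaScale B := by
  have hL := constL_nonneg hB
  have h1 := beta1_nonneg (H := H) (X := X) (η := η) hB hε t
  have h2 := le_beta2 (B := B) (H := H) (X := X) (η := η) (ε := ε) t
  have h3 : 0 ≤ 2 * constL B * ε * t := by positivity
  have h4 := betaScale_pos B
  rw [le_div_iff₀ h4, beta_eq, mul_comm]
  gcongr
  linarith

omit [CompleteSpace H] in
lemma beta_nonneg (hB : 0 ≤ B) (hε : 0 ≤ ε) (t : ℕ) : 0 ≤ beta H X B ε η t := by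
  have h := (beta1_nonneg (H := H) (X := X) (η := η) hB hε t).trans (beta1_le_beta hB hε t)
  have h4 := betaScale_pos B
  by_contra hlt
  exact absurd h (not_le.2 (div_neg_of_neg_of_pos (not_le.1 hlt) h4))

omit [CompleteSpace H] in
-- The choice `ε = 1 / T` keeps the linear terms at time `T` of constant size. This lower bound lets
-- the summand `2 * B` of the width be absorbed into a multiple of `√β`.
lemma betaScale_le_beta (hB : 0 ≤ B) {T : ℕ} (hT : 1 ≤ T) :
    betaScale B ≤ beta H X B (1 / T) η T := by
  have hT0 : (0 : ℝ) < T := by exact_mod_cast hT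
  have hL := two_le_constL hB
  have h1 := beta1_nonneg (H := H) (X := X) (η := η) (ε := 1 / T) hB (by positivity) T
  have h2 := le_beta2 (B := B) (H := H) (X := X) (η := η) (ε := 1 / T) T
  have h3 : 2 * constL B * (1 / T) * T = 2 * constL B := by field_simp
  rw [beta_eq]
  exact le_mul_of_one_le_right (betaScale_pos B).le (by linarith)

/-- The ratio between the true confidence width and the width with the parameter `β`. -/
def widthRatio (B : ℝ) : ℝ := 1 + 8 * (1 / dsigLow B + 1) / betaScale B

lemma one_le_widthRatio (B : ℝ) : 1 ≤ widthRatio B := by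
  have := dsigLow_pos B
  have := betaScale_pos B
  rw [widthRatio]
  have : 0 ≤ 8 * (1 / dsigLow B + 1) / betaScale B := by positivity
  linarith

/-! ### From optimism to regret, and from the smallest width to the rate. -/

section Regret

variable {f : H} {T : ℕ} {Ω : Type*} {mΩ : MeasurableSpace Ω} {P : Measure Ω}
  {ℱ : Filtration ℕ mΩ} {x : ℕ → Ω → EuclideanSpace ℝ (Fin d)} {y : ℕ → Ω → Bool}
  {mle opt : ℕ → Ω → H} {lam : ℝ}

/-- On the concentration event, the regret of a step is at most a multiple of its known width. -/
lemma IsRun.regret_le_width (h : IsRun P ℱ X B ε η f T x y mle opt)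
    (hker : ∀ a ∈ X, ∀ b ∈ X, ker H a b ≤ 1) (hf : ‖f‖ ≤ B) (hB : 0 ≤ B) (hlam : 0 < lam)
    (hε : 0 ≤ ε) (hε1 : ε ≤ 1) (hη0 : 0 < η) (hη1 : η ≤ 1) (hc1 : 1 ≤ coverNum H X B ε)
    {n : ℕ} {N : Fin n → H} (hN : ∀ i, ‖N i‖ ≤ B)
    (hcov : ∀ g : H, ‖g‖ ≤ B → ∃ i, ∀ a ∈ X, |g a - N i a| ≤ ε)
    {xstar : EuclideanSpace ℝ (Fin d)} (hxs : xstar ∈ X) {ω : Ω}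
    (hG : GoodScores X B ε η f T N (x · ω) (y · ω)) {t : ℕ} (ht : t ∈ Finset.Icc 1 T) :
    f xstar - f (x t ω) ≤ widthRatio B * width H X B lam ε η (x · ω) t := by
  obtain ⟨ht1, htT⟩ := Finset.mem_Icc.1 ht
  have hx : ∀ t ≤ T, x t ω ∈ X := fun t ht => h.mem t ht ω
  have hs : t - 1 ≤ T := by omega
  have hmle : 1 ≤ t - 1 → IsMLE B (x · ω) (y · ω) (t - 1) (mle (t - 1) ω) := fun h1 =>
    h.mle_spec _ (Finset.mem_Icc.2 ⟨h1, hs⟩) ω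
  have hfc : f ∈ confSet X B ε η (x · ω) (y · ω) (t - 1) (mle (t - 1) ω) :=
    ⟨hf, fun h1 => hG.logLik_le hB hε hker hx hf hN hcov (Finset.mem_Icc.2 ⟨h1, hs⟩)
      (hmle h1).1⟩
  set g := opt t ω with hg
  have hgc := h.opt_mem t ht ω
  have hmax := h.opt_max t ht ω xstar hxs f hfc
  have hsum := hG.sum_sq_le hB hε hε1 hker hx hf hN hcov hs hmle hgc
  have hdiff := abs_sub_le_pairSigma hlam (fun i : Fin (t - 1) => (x (i + 1) ω, x i ω))
    (x t ω, x (t - 1) ω) (g - f)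
  have hnorm : ‖g - f‖ ≤ 2 * B := (norm_sub_le _ _).trans (by linarith [hgc.1])
  have hfin : ∑ i : Fin (t - 1), ((g - f) (x (i + 1) ω) - (g - f) (x i ω)) ^ 2 =
      ∑ τ ∈ Finset.Icc 1 (t - 1), (incr (x · ω) g τ - incr (x · ω) f τ) ^ 2 := by
    have h0 : Finset.Icc 1 (t - 1) = Finset.Ico (0 + 1) (t - 1 + 1) := by ext; simp
    rw [h0, ← Finset.sum_Ico_add' (fun τ => (incr (x · ω) g τ - incr (x · ω) f τ) ^ 2) 0 (t - 1) 1,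
      ← Finset.range_eq_Ico,
      ← Fin.sum_univ_eq_sum_range (fun τ => (incr (x · ω) g (τ + 1) - incr (x · ω) f (τ + 1)) ^ 2)]
    refine Finset.sum_congr rfl fun i _ => ?_
    simp only [incr, RKHS.coe_sub, Pi.sub_apply, Nat.add_sub_cancel]
    ring
  -- The confidence set rests on `t - 1` comparisons, whereas the width of step `t` uses `β` at `t`.
  have hβ := (beta1_mono (H := H) (X := X) hB hε hη0 hη1 hc1 (Nat.sub_le t 1)).trans
    (beta1_le_beta (H := H) (X := X) (η := η) hB hε t)
  have hb0 := beta_nonneg (H := H) (X := X) (η := η) hB hε t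
  have hm0 := dsigLow_pos B
  have hk0 := betaScale_pos B
  have hA := one_le_widthRatio B
  simp only at hdiff
  rw [hfin] at hdiff
  have hroot : √(2 * ‖g - f‖ ^ 2 + lam⁻¹ *
      ∑ τ ∈ Finset.Icc 1 (t - 1), (incr (x · ω) g τ - incr (x · ω) f τ) ^ 2) ≤
      widthRatio B * (2 * (2 * B + (√lam)⁻¹ * √(beta H X B ε η t))) := by
    refine Real.sqrt_le_iff.2 ⟨by positivity, ?_⟩
    set q := (√lam)⁻¹ * √(beta H X B ε η t) with hq
    have hq0 : 0 ≤ q := by positivity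
    have hq2 : q ^ 2 = lam⁻¹ * beta H X B ε η t := by
      rw [hq, mul_pow, inv_pow, Real.sq_sqrt hlam.le, Real.sq_sqrt hb0]
    have e1 : ‖g - f‖ ^ 2 ≤ (2 * B) ^ 2 := by gcongr
    have e2 : lam⁻¹ * ∑ τ ∈ Finset.Icc 1 (t - 1), (incr (x · ω) g τ - incr (x · ω) f τ) ^ 2 ≤
        widthRatio B * q ^ 2 := by
      calc _ ≤ lam⁻¹ * (8 * (1 / dsigLow B + 1) * (beta H X B ε η t / betaScale B)) := by
            gcongr
            exact hsum.trans (by gcongr)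
        _ = (8 * (1 / dsigLow B + 1) / betaScale B) * q ^ 2 := by rw [hq2]; ring
        _ ≤ _ := by
            gcongr
            rw [widthRatio]
            linarith
    have e3 : widthRatio B * q ^ 2 ≤ widthRatio B ^ 2 * q ^ 2 := by
      gcongr
      nlinarith
    have e4 : B ^ 2 ≤ widthRatio B ^ 2 * B ^ 2 :=
      le_mul_of_one_le_left (sq_nonneg B) (one_le_pow₀ hA)
    have e5 : 0 ≤ widthRatio B ^ 2 * (B * q) := by positivity
    have e6 : 0 ≤ widthRatio B ^ 2 * q ^ 2 := by positivity
    nlinarith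
  -- Optimism: as `f` is in the confidence set, its advantage at `xstar` over `x (t - 1)` is at most
  -- that of `g` at `x t`; subtracting the advantage of `f` at `x t` leaves an increment of `g - f`.
  calc f xstar - f (x t ω)
      ≤ (g - f) (x t ω) - (g - f) (x (t - 1) ω) := by
        simp only [RKHS.coe_sub, Pi.sub_apply]
        linarith
    _ ≤ _ := (le_abs_self _).trans hdiff
    _ ≤ widthRatio B * (2 * (2 * B + (√lam)⁻¹ * √(beta H X B ε η t))) *
        stepSigma H lam (x · ω) t := mul_le_mul_of_nonneg_right hroot (Real.sqrt_nonneg _)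
    _ = _ := by rw [width]; ring

end Regret

/-- The smallest width of a run is at most of the order `√(β γ / T)`. -/
lemma width_argmin_le (hX : IsCompact X) (hker : ∀ a ∈ X, ∀ b ∈ X, ker H a b ≤ 1)
    (hk : Continuous fun p : EuclideanSpace ℝ (Fin d) × EuclideanSpace ℝ (Fin d) =>
      ker H p.1 p.2) {lam : ℝ} (hlam : 0 < lam) (hB : 0 ≤ B) (hη0 : 0 < η) (hη1 : η ≤ 1)
    {T : ℕ} (hT : 1 ≤ T) (hc1 : 1 ≤ coverNum H X B (1 / T))
    {x : ℕ → EuclideanSpace ℝ (Fin d)} (hx : ∀ t ≤ T, x t ∈ X) {w : ℝ}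
    (hw : ∀ t ∈ Finset.Icc 1 T, w ≤ width H X B lam (1 / T) (η / 2) x t) :
    w ≤ 2 * (2 * B / √(betaScale B) + 2 * (√lam)⁻¹) * √(2 * (lam + 2)) *
      (√(beta H X B (1 / T) η T * infoGain H X lam T) / √T) := by
  have hT0 : (0 : ℝ) < T := by exact_mod_cast hT
  have hε : (0 : ℝ) ≤ 1 / T := by positivity
  have hκ := betaScale_pos B
  set b := beta H X B (1 / T) η T with hb
  have hbκ : betaScale B ≤ b := betaScale_le_beta hB hT
  have hb0 : 0 ≤ b := hκ.le.trans hbκ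
  set W := 2 * (2 * B + (√lam)⁻¹ * √(beta H X B (1 / T) (η / 2) T)) with hW
  have hW0 : 0 ≤ W := by positivity
  -- The minimum is at most the average, and monotonicity replaces each `β` by its value at `T`.
  have hsum : T * w ≤ W * ∑ t ∈ Finset.Icc 1 T, stepSigma H lam x t := by
    calc T * w = ∑ t ∈ Finset.Icc 1 T, w := by simp
      _ ≤ ∑ t ∈ Finset.Icc 1 T, W * stepSigma H lam x t := by
        refine Finset.sum_le_sum fun t ht => (hw t ht).trans ?_
        obtain ⟨ht1, htT⟩ := Finset.mem_Icc.1 ht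
        have := beta_mono (H := H) (X := X) hB hε (half_pos hη0) (by linarith) hc1 ht1 htT
        have := stepSigma_nonneg (H := H) lam x t
        rw [width, hW]
        gcongr
      _ = _ := by rw [Finset.mul_sum]
  have hcs : ∑ t ∈ Finset.Icc 1 T, stepSigma H lam x t ≤
      √T * (√(2 * (lam + 2)) * √(infoGain H X lam T)) := by
    rw [← Real.sqrt_mul (by positivity), ← Real.sqrt_mul hT0.le]
    refine Real.le_sqrt_of_sq_le ?_
    refine sq_sum_le_card_mul_sum_sq.trans ?_
    rw [Nat.card_Icc, Nat.add_sub_cancel]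
    gcongr
    exact sum_stepSigma_sq_le hX hker hk hlam x hx
  have hWb : W ≤ 2 * (2 * B / √(betaScale B) + 2 * (√lam)⁻¹) * √b := by
    have e1 : √(beta H X B (1 / T) (η / 2) T) ≤ 2 * √b := by
      calc _ ≤ √(2 ^ 2 * b) := Real.sqrt_le_sqrt (by
              linarith [beta_half_le (H := H) (X := X) hB hε hη0 hη1 hc1 hT])
        _ = 2 * √b := by rw [Real.sqrt_mul (by positivity), Real.sqrt_sq (by norm_num)]
    have e2 : 2 * B ≤ 2 * B / √(betaScale B) * √b := by
      rw [div_mul_eq_mul_div, le_div_iff₀ (Real.sqrt_pos.2 hκ)]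
      gcongr
    have e3 : (√lam)⁻¹ * √(beta H X B (1 / T) (η / 2) T) ≤ (√lam)⁻¹ * (2 * √b) := by gcongr
    rw [hW]
    linarith
  rw [Real.sqrt_mul hb0]
  have hfin : T * w ≤ (2 * (2 * B / √(betaScale B) + 2 * (√lam)⁻¹) * √b) *
      (√T * (√(2 * (lam + 2)) * √(infoGain H X lam T))) :=
    hsum.trans (mul_le_mul hWb hcs
      (Finset.sum_nonneg fun t _ => stepSigma_nonneg _ _ _) (hW0.trans hWb))
  have hTs : (T : ℝ) = √T * √T := (Real.mul_self_sqrt hT0.le).symm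
  have hsT : 0 < √(T : ℝ) := Real.sqrt_pos.2 hT0
  rw [mul_div_assoc', le_div_iff₀ hsT]
  refine le_of_mul_le_mul_left ?_ hsT
  calc √T * (w * √T) = T * w := by rw [hTs]; simp only [Real.sqrt_mul_self hsT.le]; ring
    _ ≤ _ := hfin
    _ = _ := by ring

end Confidence

end PopBO

end

/-! ### The convergence guarantee. -/

theorem theorem6 (B lam : ℝ) (hB : 0 ≤ B) (hlam : 0 < lam) :
    ∃ C : ℝ, 0 < C ∧
      ∀ (d : ℕ) (X : Set (EuclideanSpace ℝ (Fin d))), IsCompact X → X.Nonempty →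
      ∀ (H : Type*) [NormedAddCommGroup H] [InnerProductSpace ℝ H] [CompleteSpace H]
        [RKHS ℝ H (EuclideanSpace ℝ (Fin d)) ℝ],
        (∀ a ∈ X, ∀ b ∈ X, PopBO.ker H a b ≤ 1) →
        Continuous (fun p : EuclideanSpace ℝ (Fin d) × EuclideanSpace ℝ (Fin d) =>
          PopBO.ker H p.1 p.2) →
      ∀ f : H, ‖f‖ ≤ B →
      ∀ xstar ∈ X, (∀ a ∈ X, f a ≤ f xstar) →
      ∀ (T : ℕ) (δ : ℝ), 1 ≤ T → 0 < δ → δ < 1 →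
      ∀ (Ω : Type*) [mΩ : MeasurableSpace Ω] (P : Measure Ω) [IsProbabilityMeasure P]
        (ℱ : Filtration ℕ mΩ) (x : ℕ → Ω → EuclideanSpace ℝ (Fin d)) (y : ℕ → Ω → Bool)
        (mle opt : ℕ → Ω → H),
        PopBO.IsRun P ℱ X B (1 / T) (δ / 2) f T x y mle opt →
        1 - δ ≤ P.real {ω | ∀ tstar ∈ Finset.Icc 1 T,
          (∀ t ∈ Finset.Icc 1 T,
            PopBO.width H X B lam (1 / T) (δ / 2) (x · ω) tstar ≤
              PopBO.width H X B lam (1 / T) (δ / 2) (x · ω) t) →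
          f xstar - f (x tstar ω) ≤
            C * (√(PopBO.beta H X B (1 / T) δ T * PopBO.infoGain H X lam T) / √T)} := by

  have hκ := PopBO.betaScale_pos B
  have hA : 0 < PopBO.widthRatio B := zero_lt_one.trans_le (PopBO.one_le_widthRatio B)
  have hsl : 0 < √lam := Real.sqrt_pos.2 hlam
  refine ⟨PopBO.widthRatio B * (2 * (2 * B / √(PopBO.betaScale B) + 2 * (√lam)⁻¹) *
    √(2 * (lam + 2))), by positivity, ?_⟩
  intro d X hX hXne H _ _ _ _ hker hk f hf xstar hxs hmax T δ hT hδ0 hδ1 Ω mΩ P _ ℱ x y mle opt hrun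
  have hT0 : (0 : ℝ) < T := by exact_mod_cast hT
  -- For `B = 0` the tail bound has no positive weight bound, but then `f = 0` and there is no
  -- regret.
  rcases hB.eq_or_lt with rfl | hB0
  · have hf0 : f = 0 := norm_le_zero_iff.1 hf
    have huniv : ∀ s : Set Ω, (∀ ω, ω ∈ s) → 1 - δ ≤ P.real s := fun s hs => by
      rw [Set.eq_univ_of_forall hs, probReal_univ]
      linarith
    refine huniv _ fun ω tstar _ _ => ?_
    rw [hf0]
    simp only [RKHS.coe_zero, Pi.zero_apply, sub_self]
    positivity
  have hε0 : (0 : ℝ) < 1 / T := by positivity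
  have hε1 : (1 : ℝ) / T ≤ 1 := by
    rw [div_le_one hT0]
    exact_mod_cast hT
  obtain ⟨hc1, N, hN, hcov⟩ := PopBO.exists_net (B := B) hX hker hk hB hε0
  have hbad := hrun.measure_not_good_le hker hk hf hB0 (half_pos hδ0) (by linarith) hc1 hN
  set bad := {ω | ¬ PopBO.GoodScores X B (1 / T) (δ / 2) f T N (x · ω) (y · ω)}
  -- Subadditivity on `univ ⊆ s ∪ bad` avoids any measurability of the success set.
  have hcover : ∀ s : Set Ω, (∀ ω, ω ∉ bad → ω ∈ s) → 1 - δ ≤ P.real s := fun s hs => by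
    have h1 : P.real Set.univ ≤ P.real (s ∪ bad) :=
      measureReal_mono (fun ω _ => (em (ω ∈ bad)).elim Or.inr fun h => Or.inl (hs ω h))
        (measure_ne_top P _)
    have h2 := measureReal_union_le (μ := P) s bad
    rw [probReal_univ] at h1
    linarith
  refine hcover _ fun ω hω tstar htstar hmin => ?_
  have hG : PopBO.GoodScores X B (1 / T) (δ / 2) f T N (x · ω) (y · ω) := not_not.1 hω
  have h1 := hrun.regret_le_width hker hf hB hlam hε0.le hε1 (half_pos hδ0) (by linarith) hc1 hN
    hcov hxs hG htstar
  have h2 := PopBO.width_argmin_le (x := (x · ω)) hX hker hk hlam hB hδ0 hδ1.le hT hc1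
    (fun t ht => hrun.mem t ht ω) hmin
  calc _ ≤ _ := h1
    _ ≤ _ := mul_le_mul_of_nonneg_left h2 hA.le
    _ = _ := by ring
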